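/- Let $d\ge 1$ and identify $\mathbb C^d$ with $\mathbb R^{2d}$ via $z_j=x_j+iy_j$. For $\lambda\in\mathbb R\setminus\{0\}$ let $L_\lambda$ be the special Hermite operator $$L_\lambda=-\Delta_{\mathbb C^d}+\tfrac14\lambda^2\|z\|^2-i\lambda\sum_{j=1}^d\Big(x_j\frac{\partial}{\partial y_j}-y_j\frac{\partial}{\partial x_j}\Big),\qquad \Delta_{\mathbb C^d}=\sum_{j=1}^d\Big(\frac{\partial^2}{\partial x_j^2}+\frac{\partial^2}{\partial y_j^2}\Big).$$ A solution of the Schrödinger equation $$i\partial_t u=L_\lambda u\ \text{ on }\mathbb C^d\times(0,\infty),\qquad u(\cdot,0)=u_0\in L^2(\mathbb C^d),$$ is a curve $u\in C([0,\infty);L^2(\mathbb C^d))$ with $u(\cdot,0)=u_0$ that satisfies the equation in the sense of tempered distributions: for every Schwartz function $\varphi$ on $\mathbb C^d$ and every $s>0$, $$i\,\frac{d}{ds}\int_{\mathbb C^d}u(z,s)\,\overline{\varphi(z)}\,dz=\int_{\mathbb C^d}u(z,s)\,\overline{L_\lambda\varphi(z)}\,dz .$$ **Theorem.** Fix $\lambda\in\mathbb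 R\setminus\{0\}$, and let $E,\Omega\subset\mathbb C^d$ be Lebesgue measurable sets of finite Lebesgue measure. Let $t\in(0,\infty)$ be such that $\lambda t\notin\pi\mathbb Z$. Then there is a constant $C=C(\lambda,t,E,\Omega)>0$ such that every solution $u$ of the equation above, with any initial datum $u_0\in L^2(\mathbb C^d)$, satisfies $$\int_{\mathbb C^d}|u_0(z)|^2\,dz\le C\left(\int_{\mathbb C^d\setminus E}|u_0(z)|^2\,dz+\int_{\mathbb C^d\setminus\Omega}|u(z,t)|^2\,dz\right).$$ -/

import Mathlib

open MeasureTheory Set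
open scoped SchwartzMap ENNReal ComplexConjugate

noncomputable section

/-- The space `ℂ^d` with its Euclidean norm and Lebesgue measure. -/
abbrev Cd (d : ℕ) : Type := EuclideanSpace ℂ (Fin d)

/-- The real partial derivative `∂f/∂x_j` on `ℂ^d`, where `z_j = x_j + i y_j`. -/
def partialX {d : ℕ} (j : Fin d) (f : Cd d → ℂ) (z : Cd d) : ℂ :=
  fderiv ℝ f z (EuclideanSpace.single j 1)

/-- The real partial derivative `∂f/∂y_j` on `ℂ^d`, where `z_j = x_j + i y_j`. -/
def partialY {d : ℕ} (j : Fin d) (f : Cd d → ℂ) (z : Cd d) : ℂ :=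
  fderiv ℝ f z (EuclideanSpace.single j Complex.I)

/-- The Laplacian `∑_j (∂²/∂x_j² + ∂²/∂y_j²)` on `ℂ^d`. -/
def laplacianCd {d : ℕ} (f : Cd d → ℂ) (z : Cd d) : ℂ :=
  ∑ j : Fin d, (partialX j (partialX j f) z + partialY j (partialY j f) z)

/-- The special Hermite operator
`L_lam = -Δ + (1/4) lam² ‖z‖² - i lam ∑_j (x_j ∂/∂y_j - y_j ∂/∂x_j)`,
as a differential operator on smooth functions. -/
def specialHermite {d : ℕ} (lam : ℝ) (f : Cd d → ℂ) (z : Cd d) : ℂ :=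
  -laplacianCd f z + (1 / 4 : ℂ) * (lam : ℂ) ^ 2 * (‖z‖ : ℂ) ^ 2 * f z
    - Complex.I * (lam : ℂ) *
      ∑ j : Fin d, (((z j).re : ℂ) * partialY j f z - ((z j).im : ℂ) * partialX j f z)

/-- `u` is a solution, with initial datum `u₀ ∈ L²(ℂ^d)`, of the Schrödinger equation
`i ∂_t u = L_lam u` on `ℂ^d × (0, ∞)`, `u(·, 0) = u₀`: the curve `u` is continuous from `[0, ∞)`
into `L²(ℂ^d)` and satisfies the equation in the sense of tempered distributions, that is, for
every Schwartz function `φ` and every time `t > 0`,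
`i (d/dt) ⟨u(t), φ⟩ = ⟨u(t), L_lam φ⟩` with `⟨f, g⟩ = ∫ f conj(g)`
(the operator `L_lam` is formally self-adjoint).
Only the values of `u` on `[0, ∞)` matter. -/
structure IsSchrodingerSolution {d : ℕ} (lam : ℝ)
    (u₀ : Lp ℂ 2 (volume : Measure (Cd d))) (u : ℝ → Lp ℂ 2 (volume : Measure (Cd d))) :
    Prop where
  continuousOn : ContinuousOn u (Ici 0)
  initial : u 0 = u₀
  equation : ∀ φ : 𝓢(Cd d, ℂ), ∀ t : ℝ, 0 < t → ∃ D : ℂ,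
    HasDerivAt (fun s : ℝ => ∫ z, (u s) z * conj (φ z)) D t ∧
      Complex.I * D = ∫ z, (u t) z * conj (specialHermite lam (φ : Cd d → ℂ) z)

end

/-!
At time `t` the solution is, up to a unimodular quadratic phase, a constant and a complex dilation,
the Fourier transform of `u₀` times another unimodular quadratic phase; this is where `sin (lam t)`
must not vanish, that is, where `lam t ∉ πℤ` enters. The estimate is therefore the Amrein–Berthier
uncertainty inequality for sets of finite measure, applied to `E` and a dilate of `Ω`.

**Representation of the solution.** Write `lam = 4κε` with `κ > 0` and `ε = ±1`. For `ε = 1` the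
functions `(b·z + ρ)ⁿ exp (c·z̄ - κ‖z‖²)` with `ρ = -(b·c)/(2κ)` are Schwartz eigenfunctions of the
special Hermite operator with eigenvalue `4κ(2n + d)` (`specialHermite_polyGauss`); for `ε = -1` the
variables `z` and `z̄` change places. The weak equation becomes an ordinary differential equation
for the pairing of `u` with such a function (`IsSchrodingerSolution.pairing_eigenfunction`), so no
spectral theory is needed. Summing over `n` with weights `1 / n!` gives the evolution of the
pairings with all Gaussians `exp (b·z + ρ + c·z̄ - κ‖z‖²)`: it multiplies `b·z + ρ` by a unimodular
number (`IsSchrodingerSolution.pairing_gaussian`). An explicit Gaussian Fourier transform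
(`fourier_coherentState`) and Plancherel turn these pairings into those of a dilated Fourier
transform, and the Gaussians are total in `L²` (`eq_zero_of_integral_mul_gaussian_char`). This
proves `IsSchrodingerSolution.exists_fourier_representation`.

**Uncertainty inequality.** For sets `S`, `F` of finite measure, cutting off to `S`, taking the
Fourier transform and cutting off to `F` is a Hilbert–Schmidt operator. Hence the space of functions
supported in `S` with Fourier transform supported in `F` has dimension at most `|S| |F|`
(`finrank_timeBandLimited_le`). A nonzero element would, by successive translations that enlarge the
support only slightly, produce arbitrarily many independent functions supported in sets of bounded
measure, so the space is trivial (`timeBandLimited_eq_bot`). By weak compactness the operator then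
has norm strictly less than one (`exists_norm_cutoff_fourier_cutoff_le`), and this is equivalent to
the inequality `amrein_berthier`.
-/

open FourierTransform Filter Topology

/-! ### The Fourier transform on `L¹ ∩ L²` -/

section FourierLp

variable {V : Type*} [NormedAddCommGroup V] [InnerProductSpace ℝ V] [FiniteDimensional ℝ V]
  [MeasurableSpace V] [BorelSpace V]

/-- On integrable functions the Fourier transform of `L²`, defined by extension from Schwartz
functions, is given by the Fourier integral. -/
lemma fourier_toLp_ae_eq {f : V → ℂ} (h1 : Integrable f) (h2 : MemLp f 2 volume) :
    (𝓕 (h2.toLp f) : Lp ℂ 2 (volume : Measure V)) =ᵐ[volume] 𝓕 f := by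
  have hcont : Continuous (𝓕 f) :=
    VectorFourier.fourierIntegral_continuous Real.continuous_fourierChar
      (by exact continuous_inner) h1
  refine ae_eq_of_integral_contDiff_smul_eq
    (((Lp.memLp (𝓕 (h2.toLp f) : Lp ℂ 2 (volume : Measure V))).locallyIntegrable (by norm_num)))
    hcont.locallyIntegrable fun g hg hgc => ?_
  have hgC : ContDiff ℝ (⊤ : ℕ∞) (fun x => (g x : ℂ)) := Complex.ofRealCLM.contDiff.comp hg
  have hgcC : HasCompactSupport (fun x => (g x : ℂ)) := hgc.comp_left (g := Complex.ofReal) rfl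
  set G : 𝓢(V, ℂ) := hgcC.toSchwartzMap hgC with hG
  have hGx : ∀ x, G x = g x := fun x => rfl
  have e1 : ∫ x, g x • (𝓕 (h2.toLp f) : Lp ℂ 2 (volume : Measure V)) x =
      ∫ x, (𝓕 G) x • (h2.toLp f) x := by
    have := congrArg (fun T => T G) (Lp.fourier_toTemperedDistribution_eq (h2.toLp f))
    simp only [TemperedDistribution.fourier_apply, Lp.toTemperedDistribution_apply] at this
    rw [this]
    rfl
  have e2 : ∫ x, g x • 𝓕 f x = ∫ x, (𝓕 G) x • f x := by
    have := VectorFourier.integral_fourierIntegral_smul_eq_flip (μ := volume) (ν := volume)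
      (L := innerₗ V) Real.continuous_fourierChar (by exact continuous_inner) h1 G.integrable
    rw [flip_innerₗ] at this
    calc ∫ x, g x • 𝓕 f x = ∫ x, 𝓕 f x • G x := by
          congr 1; ext x; simp [hGx, mul_comm]
      _ = _ := this
      _ = _ := by
          congr 1; ext x; rw [smul_eq_mul, smul_eq_mul, mul_comm]; rfl
  rw [e1, e2]
  refine integral_congr_ae ?_
  filter_upwards [h2.coeFn_toLp] with x hx
  rw [hx]

end FourierLp

/-! ### Cutting off square integrable functions -/

section Cutoff

variable {α : Type*} [MeasurableSpace α] {μ : Measure α}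

lemma Lp_norm_sq_eq_integral (f : Lp ℂ 2 μ) : ‖f‖ ^ 2 = ∫ x, ‖f x‖ ^ 2 ∂μ := by
  have h : inner ℂ f f = ((‖f‖ ^ 2 : ℝ) : ℂ) := by
    rw [inner_self_eq_norm_sq_to_K]; push_cast; rfl
  rw [L2.inner_def] at h
  have h2 : ∫ x, inner ℂ (f x) (f x) ∂μ = ((∫ x, ‖f x‖ ^ 2 ∂μ : ℝ) : ℂ) := by
    rw [← integral_complex_ofReal]
    congr 1; ext x
    rw [inner_self_eq_norm_sq_to_K]; push_cast; rfl
  rw [h2] at h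
  exact_mod_cast h.symm

lemma Lp_integrable_norm_sq (f : Lp ℂ 2 μ) : Integrable (fun x => ‖f x‖ ^ 2) μ :=
  (memLp_two_iff_integrable_sq_norm (Lp.aestronglyMeasurable f)).1 (Lp.memLp f)

/-- Restriction of square integrable functions to a measurable set `S`, as a bounded operator
on `L²`: multiplication by the indicator function of `S`. -/
noncomputable def cutoff (μ : Measure α) {S : Set α} (hS : MeasurableSet S) :
    Lp ℂ 2 μ →L[ℂ] Lp ℂ 2 μ :=
  LinearMap.mkContinuous
    { toFun := fun f => ((Lp.memLp f).indicator hS).toLp _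
      map_add' := fun f g => by
        rw [← MemLp.toLp_add]
        refine MemLp.toLp_congr _ _ ?_
        filter_upwards [Lp.coeFn_add f g] with x hx
        by_cases hxS : x ∈ S
        · simp only [indicator_of_mem hxS, hx, Pi.add_apply]
        · simp only [indicator_of_notMem hxS, Pi.add_apply, add_zero]
      map_smul' := fun c f => by
        rw [RingHom.id_apply, ← MemLp.toLp_const_smul]
        refine MemLp.toLp_congr _ _ ?_
        filter_upwards [Lp.coeFn_smul c f] with x hx
        by_cases hxS : x ∈ S
        · simp only [indicator_of_mem hxS, hx, Pi.smul_apply]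
        · simp only [indicator_of_notMem hxS, Pi.smul_apply, smul_zero] }
    1 (fun f => by
      rw [one_mul]
      refine Lp.norm_le_norm_of_ae_le ?_
      filter_upwards [((Lp.memLp f).indicator hS).coeFn_toLp] with x hx
      simp only [LinearMap.coe_mk, AddHom.coe_mk, hx]
      exact norm_indicator_le_norm_self _ _)

lemma coeFn_cutoff {S : Set α} (hS : MeasurableSet S) (f : Lp ℂ 2 μ) :
    cutoff μ hS f =ᵐ[μ] S.indicator f :=
  ((Lp.memLp f).indicator hS).coeFn_toLp

lemma norm_cutoff_sq {S : Set α} (hS : MeasurableSet S) (f : Lp ℂ 2 μ) :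
    ‖cutoff μ hS f‖ ^ 2 = ∫ x in S, ‖f x‖ ^ 2 ∂μ := by
  rw [Lp_norm_sq_eq_integral, ← integral_indicator hS]
  refine integral_congr_ae ?_
  filter_upwards [coeFn_cutoff hS f] with x hx
  rw [hx]
  by_cases hxS : x ∈ S <;> simp [hxS]

lemma norm_cutoff_le {S : Set α} (hS : MeasurableSet S) (f : Lp ℂ 2 μ) :
    ‖cutoff μ hS f‖ ≤ ‖f‖ :=
  (LinearMap.mkContinuous_norm_le _ zero_le_one _ |> ContinuousLinearMap.le_of_opNorm_le _) f
    |>.trans_eq (one_mul _)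

lemma norm_sq_cutoff_add_compl {S : Set α} (hS : MeasurableSet S) (f : Lp ℂ 2 μ) :
    ‖cutoff μ hS f‖ ^ 2 + ‖cutoff μ hS.compl f‖ ^ 2 = ‖f‖ ^ 2 := by
  rw [norm_cutoff_sq, norm_cutoff_sq, Lp_norm_sq_eq_integral,
    integral_add_compl hS (Lp_integrable_norm_sq f)]

lemma cutoff_add_compl {S : Set α} (hS : MeasurableSet S) (f : Lp ℂ 2 μ) :
    cutoff μ hS f + cutoff μ hS.compl f = f := by
  refine Lp.ext ?_
  filter_upwards [coeFn_cutoff hS f, coeFn_cutoff hS.compl f,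
    Lp.coeFn_add (cutoff μ hS f) (cutoff μ hS.compl f)] with x h1 h2 h3
  rw [h3, Pi.add_apply, h1, h2, ← Pi.add_apply, indicator_self_add_compl]

lemma cutoff_eq_self_iff {S : Set α} (hS : MeasurableSet S) (f : Lp ℂ 2 μ) :
    cutoff μ hS f = f ↔ ∀ᵐ x ∂μ, x ∉ S → f x = 0 := by
  constructor
  · intro h
    filter_upwards [coeFn_cutoff hS f] with x hx hxS
    rw [h] at hx
    rw [hx, indicator_of_notMem hxS]
  · intro h
    refine Lp.ext ?_
    filter_upwards [coeFn_cutoff hS f, h] with x hx hx0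
    rw [hx]
    by_cases hxS : x ∈ S <;> simp [hxS, hx0]

lemma cutoff_eq_self_of_norm_eq {S : Set α} (hS : MeasurableSet S) {f : Lp ℂ 2 μ}
    (h : ‖cutoff μ hS f‖ = ‖f‖) : cutoff μ hS f = f := by
  have h1 := norm_sq_cutoff_add_compl hS f
  rw [h] at h1
  have h2 : cutoff μ hS.compl f = 0 := by
    rw [← norm_eq_zero, ← sq_eq_zero_iff]; linarith
  have h3 := cutoff_add_compl hS f
  rwa [h2, add_zero] at h3

end Cutoff

/-! ### Time- and band-limited functions -/

section FourierCutoff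

variable {V : Type*} [NormedAddCommGroup V] [InnerProductSpace ℝ V] [FiniteDimensional ℝ V]
  [MeasurableSpace V] [BorelSpace V]

lemma memLp_indicator_fourierChar {S : Set V} (hS : MeasurableSet S) (hfin : volume S ≠ ∞)
    (ξ : V) :
    MemLp (S.indicator fun x => ((Real.fourierChar (inner ℝ x ξ) : Circle) : ℂ)) 2 volume := by
  have hc : Continuous fun x : V => ((Real.fourierChar (inner ℝ x ξ) : Circle) : ℂ) := by
    have := Real.continuous_fourierChar
    fun_prop
  refine MemLp.of_le (memLp_indicator_const 2 hS (1 : ℂ) (Or.inr hfin))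
    (hc.aestronglyMeasurable.indicator hS) (ae_of_all _ fun x => ?_)
  by_cases hx : x ∈ S
  · simpa [hx] using (Circle.norm_coe _).le
  · simp [hx]

/-- The character `x ↦ e^{2πi⟨x, ξ⟩}` cut off to a set `S` of finite measure, as an element of
`L²`. -/
noncomputable def cutoffChar {S : Set V} (hS : MeasurableSet S) (hfin : volume S ≠ ∞) (ξ : V) :
    Lp ℂ 2 (volume : Measure V) :=
  (memLp_indicator_fourierChar hS hfin ξ).toLp _

lemma norm_cutoffChar_sq {S : Set V} (hS : MeasurableSet S) (hfin : volume S ≠ ∞) (ξ : V) :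
    ‖cutoffChar hS hfin ξ‖ ^ 2 = volume.real S := by
  rw [Lp_norm_sq_eq_integral, ← integral_indicator_one hS]
  refine integral_congr_ae ?_
  filter_upwards [(memLp_indicator_fourierChar hS hfin ξ).coeFn_toLp] with x hx
  rw [cutoffChar, hx]
  by_cases hxS : x ∈ S
  · simpa [hxS] using Or.inl (Circle.norm_coe _)
  · simp [hxS]

lemma integrable_indicator_of_Lp {S : Set V} (hS : MeasurableSet S) (hfin : volume S ≠ ∞)
    (f : Lp ℂ 2 (volume : Measure V)) : Integrable (S.indicator f) := by
  rw [integrable_indicator_iff hS]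
  have : IsFiniteMeasure (volume.restrict S) := ⟨by simpa using hfin.lt_top⟩
  exact ((Lp.memLp f).restrict S).integrable (by norm_num)

/-- The Fourier transform of a function cut off to a set of finite measure is given by
`L²` inner products. -/
lemma fourier_cutoff_ae_eq {S : Set V} (hS : MeasurableSet S) (hfin : volume S ≠ ∞)
    (f : Lp ℂ 2 (volume : Measure V)) :
    (𝓕 (cutoff volume hS f) : Lp ℂ 2 (volume : Measure V)) =ᵐ[volume]
      fun ξ => inner ℂ (cutoffChar hS hfin ξ) f := by
  have h := fourier_toLp_ae_eq (integrable_indicator_of_Lp hS hfin f)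
    ((Lp.memLp f).indicator hS)
  filter_upwards [h] with ξ hξ
  refine hξ.trans ?_
  rw [Real.fourier_eq, L2.inner_def]
  refine integral_congr_ae ?_
  filter_upwards [(memLp_indicator_fourierChar hS hfin ξ).coeFn_toLp] with x hx
  rw [cutoffChar, hx]
  by_cases hxS : x ∈ S
  · simp only [hxS, indicator_of_mem]
    rw [AddChar.map_neg_eq_inv, Circle.smul_def, Circle.coe_inv_eq_conj, RCLike.inner_apply,
      smul_eq_mul, mul_comm]
  · simp [hxS]

lemma norm_cutoff_fourier_cutoff_sq {S F : Set V} (hS : MeasurableSet S) (hfin : volume S ≠ ∞)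
    (hF : MeasurableSet F) (f : Lp ℂ 2 (volume : Measure V)) :
    ‖cutoff volume hF (𝓕 (cutoff volume hS f))‖ ^ 2 =
      ∫ ξ in F, ‖inner ℂ (cutoffChar hS hfin ξ) f‖ ^ 2 := by
  rw [norm_cutoff_sq]
  refine integral_congr_ae (ae_restrict_of_ae ?_)
  filter_upwards [fourier_cutoff_ae_eq hS hfin f] with ξ hξ
  rw [hξ]

lemma aestronglyMeasurable_inner_cutoffChar {S : Set V} (hS : MeasurableSet S)
    (hfin : volume S ≠ ∞) (f : Lp ℂ 2 (volume : Measure V)) :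
    AEStronglyMeasurable (fun ξ => inner ℂ (cutoffChar hS hfin ξ) f) volume :=
  (Lp.aestronglyMeasurable _).congr (fourier_cutoff_ae_eq hS hfin f)

lemma norm_sq_inner_cutoffChar_le {S : Set V} (hS : MeasurableSet S)
    (hfin : volume S ≠ ∞) (f : Lp ℂ 2 (volume : Measure V)) (ξ : V) :
    ‖inner ℂ (cutoffChar hS hfin ξ) f‖ ^ 2 ≤ volume.real S * ‖f‖ ^ 2 := by
  rw [← norm_cutoffChar_sq hS hfin ξ, ← mul_pow]
  exact pow_le_pow_left₀ (norm_nonneg _) (norm_inner_le_norm _ _) 2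

/-- Hilbert–Schmidt bound: summed over an orthonormal family, the energies of the
time- and band-limited functions are at most the product of the measures. -/
lemma sum_norm_cutoff_fourier_cutoff_sq_le {S F : Set V} (hS : MeasurableSet S)
    (hSfin : volume S ≠ ∞) (hF : MeasurableSet F) (hFfin : volume F ≠ ∞) {ι : Type*} [Fintype ι]
    {v : ι → Lp ℂ 2 (volume : Measure V)} (hv : Orthonormal ℂ v) :
    ∑ i, ‖cutoff volume hF (𝓕 (cutoff volume hS (v i)))‖ ^ 2 ≤
      volume.real S * volume.real F := by
  have : IsFiniteMeasure (volume.restrict F) := ⟨by simpa using hFfin.lt_top⟩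
  simp_rw [norm_cutoff_fourier_cutoff_sq hS hSfin hF]
  have hint : ∀ i, Integrable (fun ξ => ‖inner ℂ (cutoffChar hS hSfin ξ) (v i)‖ ^ 2)
      (volume.restrict F) := fun i =>
    Integrable.of_bound
      ((aestronglyMeasurable_inner_cutoffChar hS hSfin (v i)).norm.pow 2).restrict
      (volume.real S * ‖v i‖ ^ 2) (ae_of_all _ fun ξ => by
        rw [Real.norm_of_nonneg (by positivity)]
        exact norm_sq_inner_cutoffChar_le hS hSfin (v i) ξ)
  rw [← integral_finsetSum _ fun i _ => hint i]
  calc ∫ ξ in F, ∑ i, ‖inner ℂ (cutoffChar hS hSfin ξ) (v i)‖ ^ 2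
      ≤ ∫ _ in F, volume.real S := by
        refine integral_mono (integrable_finsetSum _ fun i _ => hint i) (integrable_const _)
          fun ξ => ?_
        rw [← norm_cutoffChar_sq hS hSfin ξ]
        simp_rw [norm_inner_symm (cutoffChar hS hSfin ξ)]
        exact hv.sum_inner_products_le _
    _ = volume.real S * volume.real F := by simp [mul_comm]

/-- Time- and band-limiting to sets of finite measure turns weak convergence into convergence of
norms. -/
lemma tendsto_norm_cutoff_fourier_cutoff {S F : Set V} (hS : MeasurableSet S)
    (hSfin : volume S ≠ ∞) (hF : MeasurableSet F) (hFfin : volume F ≠ ∞)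
    {f : ℕ → Lp ℂ 2 (volume : Measure V)} {g : Lp ℂ 2 (volume : Measure V)}
    (hf : ∀ n, ‖f n‖ ≤ 1)
    (hweak : ∀ k : Lp ℂ 2 (volume : Measure V),
      Tendsto (fun n => (inner ℂ k (f n) : ℂ)) atTop (𝓝 (inner ℂ k g))) :
    Tendsto (fun n => ‖cutoff volume hF (𝓕 (cutoff volume hS (f n)))‖ ^ 2) atTop
      (𝓝 (‖cutoff volume hF (𝓕 (cutoff volume hS g))‖ ^ 2)) := by
  have : IsFiniteMeasure (volume.restrict F) := ⟨by simpa using hFfin.lt_top⟩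
  simp_rw [norm_cutoff_fourier_cutoff_sq hS hSfin hF]
  refine tendsto_integral_of_dominated_convergence (fun _ => volume.real S)
    (fun n => ((aestronglyMeasurable_inner_cutoffChar hS hSfin (f n)).norm.pow 2).restrict)
    (integrable_const _) (fun n => ae_of_all _ fun ξ => ?_) (ae_of_all _ fun ξ => ?_)
  · rw [Real.norm_of_nonneg (by positivity)]
    refine (norm_sq_inner_cutoffChar_le hS hSfin (f n) ξ).trans ?_
    exact mul_le_of_le_one_right measureReal_nonneg (pow_le_one₀ (norm_nonneg _) (hf n))
  · exact ((hweak _).norm).pow 2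

/-- The space of square integrable functions vanishing off `S` whose Fourier transform vanishes
off `F`. -/
noncomputable def timeBandLimited {S F : Set V} (hS : MeasurableSet S) (hF : MeasurableSet F) :
    Submodule ℂ (Lp ℂ 2 (volume : Measure V)) where
  carrier := {f | cutoff volume hS f = f ∧ cutoff volume hF (𝓕 f) = 𝓕 f}
  add_mem' := fun {f g} hf hg => by
    constructor
    · rw [map_add, hf.1, hg.1]
    · rw [FourierTransform.fourier_add, map_add, hf.2, hg.2]
  zero_mem' := by
    have : (𝓕 (0 : Lp ℂ 2 (volume : Measure V)) : Lp ℂ 2 (volume : Measure V)) = 0 :=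
      (Lp.fourierTransformₗᵢ V ℂ).map_zero
    exact ⟨map_zero _, by rw [this, map_zero]⟩
  smul_mem' := fun c f hf => by
    constructor
    · rw [map_smul, hf.1]
    · rw [FourierTransform.fourier_smul, map_smul, hf.2]

lemma card_le_of_orthonormal_timeBandLimited {S F : Set V} (hS : MeasurableSet S)
    (hSfin : volume S ≠ ∞) (hF : MeasurableSet F) (hFfin : volume F ≠ ∞) {ι : Type*} [Fintype ι]
    {v : ι → Lp ℂ 2 (volume : Measure V)} (hv : Orthonormal ℂ v)
    (hmem : ∀ i, v i ∈ timeBandLimited hS hF) :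
    (Fintype.card ι : ℝ) ≤ volume.real S * volume.real F := by
  refine le_trans (le_of_eq ?_) (sum_norm_cutoff_fourier_cutoff_sq_le hS hSfin hF hFfin hv)
  have : ∀ i, ‖cutoff volume hF (𝓕 (cutoff volume hS (v i)))‖ ^ 2 = 1 := fun i => by
    rw [(hmem i).1, (hmem i).2, Lp.norm_fourier_eq, hv.1 i, one_pow]
  simp [this]

/-- Gram–Schmidt turns independent families of time- and band-limited functions into orthonormal
ones, whose size is bounded by the product of the measures. -/
lemma finiteDimensional_timeBandLimited {S F : Set V} (hS : MeasurableSet S)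
    (hSfin : volume S ≠ ∞) (hF : MeasurableSet F) (hFfin : volume F ≠ ∞) :
    FiniteDimensional ℂ (timeBandLimited hS hF) := by
  set K := timeBandLimited hS hF
  by_contra hinf
  obtain ⟨N, hN⟩ := exists_nat_gt (volume.real S * volume.real F)
  -- an infinite-dimensional space contains linearly independent families of every finite size
  have hrank : (N : Cardinal) ≤ Module.rank ℂ K := by
    have h0 : Cardinal.aleph0 ≤ Module.rank ℂ K := by
      by_contra h
      exact hinf (Module.rank_lt_aleph0_iff.1 (not_le.1 h))
    exact (Cardinal.natCast_lt_aleph0).le.trans h0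
  obtain ⟨w, hcard, hli⟩ := le_rank_iff_exists_linearIndependent_finset.1 hrank
  set e : Fin N ≃ w := (finCongr hcard.symm).trans w.equivFin.symm
  have hli' : LinearIndependent ℂ (fun i : Fin N => ((e i : K) : Lp ℂ 2 (volume : Measure V))) :=
    (hli.comp e e.injective).map' K.subtype K.ker_subtype
  have hmem : ∀ i, InnerProductSpace.gramSchmidtNormed ℂ
      (fun i : Fin N => ((e i : K) : Lp ℂ 2 (volume : Measure V))) i ∈ K := fun i => by
    have h1 := InnerProductSpace.gramSchmidt_mem_span ℂ
      (fun i : Fin N => ((e i : K) : Lp ℂ 2 (volume : Measure V))) (le_refl i)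
    refine K.smul_mem _ (Submodule.span_le.2 ?_ h1)
    rintro _ ⟨j, -, rfl⟩
    exact (e j : K).2
  have := card_le_of_orthonormal_timeBandLimited hS hSfin hF hFfin
    (InnerProductSpace.gramSchmidtNormed_orthonormal hli') hmem
  rw [Fintype.card_fin] at this
  linarith

lemma finrank_timeBandLimited_le {S F : Set V} (hS : MeasurableSet S)
    (hSfin : volume S ≠ ∞) (hF : MeasurableSet F) (hFfin : volume F ≠ ∞) :
    (Module.finrank ℂ (timeBandLimited hS hF) : ℝ) ≤ volume.real S * volume.real F := by
  have := finiteDimensional_timeBandLimited hS hSfin hF hFfin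
  set b := stdOrthonormalBasis ℂ (timeBandLimited hS hF)
  have h := card_le_of_orthonormal_timeBandLimited hS hSfin hF hFfin
    (v := fun i => ((b i : timeBandLimited hS hF) : Lp ℂ 2 (volume : Measure V)))
    (b.orthonormal.comp_linearIsometry (timeBandLimited hS hF).subtypeₗᵢ) fun i => (b i).2
  rwa [Fintype.card_fin] at h

end FourierCutoff

/-! ### The Amrein–Berthier uncertainty inequality -/

section Uncertainty

variable {V : Type*} [NormedAddCommGroup V] [InnerProductSpace ℝ V] [FiniteDimensional ℝ V]
  [MeasurableSpace V] [BorelSpace V]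

lemma volume_translate (A : Set V) (x : V) :
    volume ((fun y => x + y) ⁻¹' A) = volume A := measure_preimage_add volume x A

/-- The overlap of a set with a translate is an inner product of indicator functions in `L²`, where
translation is strongly continuous. -/
lemma continuous_overlap {S A : Set V} (hS : MeasurableSet S) (hSfin : volume S ≠ ∞)
    (hA : MeasurableSet A) (hAfin : volume A ≠ ∞) :
    Continuous fun x : V => volume.real (S ∩ (fun y => x + y) ⁻¹' A) := by
  have h : ∀ x : V, volume.real (S ∩ (fun y => x + y) ⁻¹' A) =
      inner ℝ (indicatorConstLp 2 hS hSfin (1 : ℝ))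
        (DomAddAct.mk x +ᵥ indicatorConstLp 2 hA hAfin (1 : ℝ)) := fun x => by
    rw [DomAddAct.mk_vadd_indicatorConstLp,
      L2.real_inner_indicatorConstLp_one_indicatorConstLp_one hS _ hSfin
        ((volume_translate A x).trans_ne hAfin)]
  simp_rw [h]
  have : Fact ((2 : ℝ≥0∞) ≠ ∞) := ⟨by norm_num⟩
  exact continuous_const.inner ((continuous_id.vadd continuous_const).comp DomAddAct.continuous_mk)

lemma lintegral_overlap {S A : Set V} (hS : MeasurableSet S) (hA : MeasurableSet A) :
    ∫⁻ x, volume (S ∩ (fun y => x + y) ⁻¹' A) = volume A * volume S := by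
  have h1 : ∀ x : V, volume (S ∩ (fun y => x + y) ⁻¹' A) =
      ∫⁻ y, S.indicator 1 y * A.indicator 1 (x + y) := fun x => by
    rw [← lintegral_indicator_one (hS.inter (hA.preimage (measurable_const_add x)))]
    congr 1; ext y
    rw [inter_indicator_one]; rfl
  simp_rw [h1]
  have hm : Measurable fun p : V × V => S.indicator (1 : V → ℝ≥0∞) p.2 *
      A.indicator (1 : V → ℝ≥0∞) (p.1 + p.2) :=
    ((measurable_one.indicator hS).comp measurable_snd).mul
      ((measurable_one.indicator hA).comp (measurable_fst.add measurable_snd))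
  rw [lintegral_lintegral_swap hm.aemeasurable]
  have h2 : ∀ y : V, ∫⁻ x, S.indicator (1 : V → ℝ≥0∞) y * A.indicator (1 : V → ℝ≥0∞) (x + y) =
      S.indicator 1 y * volume A := fun y => by
    rw [lintegral_const_mul (S.indicator 1 y) (f := fun x => A.indicator (1 : V → ℝ≥0∞) (x + y))
        ((measurable_one.indicator hA).comp (measurable_add_const y)),
      lintegral_add_right_eq_self (μ := (volume : Measure V)) (A.indicator 1),
      lintegral_indicator_one hA]
  simp_rw [h2]
  rw [lintegral_mul_const _ (measurable_one.indicator hS), lintegral_indicator_one hS, mul_comm]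

/-- A set of finite positive measure can be translated so that it sticks out of a given larger set
of finite measure by a positive but arbitrarily small amount. -/
lemma exists_translate_union [Nontrivial V] {S A : Set V} (hS : MeasurableSet S)
    (hSfin : volume S ≠ ∞) (hA : MeasurableSet A) (hA0 : volume A ≠ 0) (hAS : A ⊆ S)
    {r : ℝ} (hr : volume.real S < r) :
    ∃ x : V, volume.real S < volume.real (S ∪ (fun y => x + y) ⁻¹' A) ∧
      volume.real (S ∪ (fun y => x + y) ⁻¹' A) < r := by
  have hAfin : volume A ≠ ∞ := measure_ne_top_of_subset hAS hSfin
  set g : V → ℝ := fun x => volume.real (S ∩ (fun y => x + y) ⁻¹' A) with hg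
  have hcont : Continuous g := continuous_overlap hS hSfin hA hAfin
  have hTfin : ∀ x : V, volume ((fun y => x + y) ⁻¹' A) ≠ ∞ := fun x => by
    rwa [volume_translate]
  have hT : ∀ x : V, volume.real ((fun y => x + y) ⁻¹' A) = volume.real A := fun x => by
    rw [measureReal_def, volume_translate, measureReal_def]
  have hunion : ∀ x, volume.real (S ∪ (fun y => x + y) ⁻¹' A) + g x =
      volume.real S + volume.real A := fun x => by
    rw [hg, measureReal_union_add_inter (hA.preimage (measurable_const_add x)) hSfin (hTfin x),
      hT]
  have hg0 : g 0 = volume.real A := by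
    simp only [hg, zero_add, preimage_id']
    rw [inter_eq_self_of_subset_right hAS]
  -- the overlap cannot be complete for all translates, since its integral is finite
  have hlt : ∃ x, g x < volume.real A := by
    by_contra! hcon
    have h1 : ∫⁻ _ : V, volume A ≤ ∫⁻ x, volume (S ∩ (fun y => x + y) ⁻¹' A) :=
      lintegral_mono fun x => by
        have := hcon x
        exact (ENNReal.toReal_le_toReal hAfin
          (measure_ne_top_of_subset inter_subset_left hSfin)).1 this
    rw [lintegral_overlap hS hA, lintegral_const, measure_univ_of_isAddLeftInvariant,
      ENNReal.mul_top hA0, top_le_iff] at h1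
    exact ENNReal.mul_ne_top hAfin hSfin h1
  obtain ⟨x₁, hx₁⟩ := hlt
  -- an intermediate overlap, attained by continuity, large enough for the union to stay below `r`
  set c := max (g x₁) (volume.real A - (r - volume.real S) / 2)
  have hc1 : g x₁ ≤ c := le_max_left _ _
  have hc2 : c < volume.real A := max_lt hx₁ (by linarith)
  have hc3 : volume.real A - (r - volume.real S) / 2 ≤ c := le_max_right _ _
  obtain ⟨x, hx⟩ := mem_range_of_exists_le_of_exists_ge hcont ⟨x₁, hc1⟩ ⟨0, hg0 ▸ hc2.le⟩
  refine ⟨x, ?_, ?_⟩ <;> linarith [hunion x]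

/-- The Fourier transform of a translate is a unimodular multiple of the Fourier transform, so
it vanishes at the same points. -/
lemma fourier_translate_eq_zero {f : Lp ℂ 2 (volume : Measure V)} (hf : Integrable f)
    (x : V) :
    ∀ᵐ ξ, (𝓕 f : Lp ℂ 2 (volume : Measure V)) ξ = 0 →
      (𝓕 (DomAddAct.mk x +ᵥ f) : Lp ℂ 2 (volume : Measure V)) ξ = 0 := by
  have hf2 : MemLp (f : V → ℂ) 2 volume := Lp.memLp f
  have hmp : MeasurePreserving (fun y : V => y + x) volume volume :=
    measurePreserving_add_right volume x
  have e1 : hf2.toLp f = f := Lp.toLp_coeFn f hf2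
  have e2 : (hf2.comp_measurePreserving hmp).toLp (f ∘ fun y => y + x) =
      DomAddAct.mk x +ᵥ f := by
    refine Lp.ext ?_
    filter_upwards [(hf2.comp_measurePreserving hmp).coeFn_toLp,
      DomAddAct.vadd_Lp_ae_eq (DomAddAct.mk x) f] with y h1 h2
    rw [h1, h2]
    simp [add_comm]
  have h1 := fourier_toLp_ae_eq hf hf2
  have h2 := fourier_toLp_ae_eq (hmp.integrable_comp_of_integrable hf)
    (hf2.comp_measurePreserving hmp)
  rw [e1] at h1
  rw [e2] at h2
  filter_upwards [h1, h2] with ξ h1 h2 h0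
  rw [h2]
  have := congrFun (VectorFourier.fourierIntegral_comp_add_right Real.fourierChar
    (volume : Measure V) (innerₗ V) (f : V → ℂ) x) ξ
  refine this.trans ?_
  have h3 : VectorFourier.fourierIntegral Real.fourierChar volume (innerₗ V) (f : V → ℂ) ξ = 0 :=
    h1.symm.trans h0
  rw [h3, smul_zero]

lemma timeBandLimited_mono {S S' F : Set V} (hS : MeasurableSet S) (hS' : MeasurableSet S')
    (hF : MeasurableSet F) (h : S ⊆ S') : timeBandLimited hS hF ≤ timeBandLimited hS' hF := by
  intro f hf
  refine ⟨?_, hf.2⟩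
  rw [cutoff_eq_self_iff]
  filter_upwards [(cutoff_eq_self_iff hS f).1 hf.1] with x hx hxS
  exact hx fun h' => hxS (h h')

/-- A square integrable function vanishing off a set of finite measure whose Fourier transform also
vanishes off a set of finite measure is zero. Otherwise its translates would generate, inside
spaces of functions supported in sets of bounded measure, subspaces of arbitrarily large dimension,
against `finrank_timeBandLimited_le`. -/
theorem timeBandLimited_eq_bot [Nontrivial V] {S F : Set V} (hS : MeasurableSet S)
    (hSfin : volume S ≠ ∞) (hF : MeasurableSet F) (hFfin : volume F ≠ ∞) :
    timeBandLimited hS hF = ⊥ := by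
  rw [Submodule.eq_bot_iff]
  intro f hf
  by_contra hf0
  set A : Set V := {y | f y ≠ 0} with hAdef
  have hA : MeasurableSet A :=
    ((Lp.stronglyMeasurable f).measurable (measurableSet_singleton 0)).compl
  have hAfin : volume A ≠ ∞ := by
    refine ne_top_of_le_ne_top hSfin (measure_mono_ae ?_)
    filter_upwards [(cutoff_eq_self_iff hS f).1 hf.1] with x hx hxA
    by_contra hxS
    exact hxA (hx hxS)
  have hA0 : volume A ≠ 0 := by
    intro h
    refine hf0 (Lp.ext ?_)
    filter_upwards [compl_mem_ae_iff.2 h, Lp.coeFn_zero ℂ 2 (volume : Measure V)] with x hx h0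
    rw [h0]
    simpa [hAdef] using hx
  have hfint : Integrable f := by
    have := integrable_indicator_of_Lp hA hAfin f
    rwa [indicator_eq_self.2 (show Function.support (f : V → ℂ) ⊆ A from subset_rfl)] at this
  have key : ∀ k : ℕ, ∃ (T : Set V) (hT : MeasurableSet T), A ⊆ T ∧ volume T ≠ ∞ ∧
      volume.real T < volume.real A + 1 ∧ k ≤ Module.finrank ℂ (timeBandLimited hT hF) := by
    intro k
    induction k with
    | zero => exact ⟨A, hA, subset_rfl, hAfin, by linarith, Nat.zero_le _⟩
    | succ k ih =>
      obtain ⟨T, hT, hAT, hTfin, hTlt, hk⟩ := ih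
      obtain ⟨x, hx1, hx2⟩ := exists_translate_union hT hTfin hA hA0 hAT hTlt
      have hP : MeasurableSet ((fun y => x + y) ⁻¹' A) := hA.preimage (measurable_const_add x)
      have hPfin : volume ((fun y => x + y) ⁻¹' A) ≠ ∞ := by rwa [volume_translate]
      have hUfin : volume (T ∪ (fun y => x + y) ⁻¹' A) ≠ ∞ :=
        measure_union_ne_top hTfin hPfin
      have hfd := finiteDimensional_timeBandLimited (hT.union hP) hUfin hF hFfin
      refine ⟨_, hT.union hP, hAT.trans subset_union_left, hUfin, hx2,
        hk.trans_lt (Submodule.finrank_lt_finrank_of_lt ?_)⟩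
      have hae := DomAddAct.vadd_Lp_ae_eq (DomAddAct.mk x) f
      rw [SetLike.lt_iff_le_and_exists]
      refine ⟨timeBandLimited_mono hT _ hF subset_union_left, DomAddAct.mk x +ᵥ f,
        ⟨(cutoff_eq_self_iff _ _).2 ?_, (cutoff_eq_self_iff _ _).2 ?_⟩, fun hmem => ?_⟩
      · filter_upwards [hae] with y hy hyU
        rw [hy]
        by_contra h
        exact hyU (Or.inr h)
      · filter_upwards [fourier_translate_eq_zero hfint x,
          (cutoff_eq_self_iff hF _).1 hf.2] with ξ h1 h2 hξ
        exact h1 (h2 hξ)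
      · -- the translate does not vanish on the part of the translated support outside `T`
        have hle : volume (T ∪ (fun y => x + y) ⁻¹' A) ≤ volume T := by
          refine measure_mono_ae ?_
          filter_upwards [hae, (cutoff_eq_self_iff hT _).1 hmem.1] with y h1 h2 hy
          by_contra hyT
          rcases hy with hy | hy
          · exact hyT hy
          · exact hy ((h1.symm.trans (h2 hyT)))
        exact absurd (ENNReal.toReal_mono hTfin hle) (not_le.2 hx1)
  obtain ⟨N, hN⟩ := exists_nat_gt ((volume.real A + 1) * volume.real F)
  obtain ⟨T, hT, -, hTfin, hTlt, hk⟩ := key N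
  have h1 := finrank_timeBandLimited_le hT hTfin hF hFfin
  have h2 : (N : ℝ) ≤ Module.finrank ℂ (timeBandLimited hT hF) := by exact_mod_cast hk
  have h3 : volume.real T * volume.real F ≤ (volume.real A + 1) * volume.real F :=
    mul_le_mul_of_nonneg_right hTlt.le measureReal_nonneg
  linarith

/-- Sequential weak compactness of the unit ball of a separable Hilbert space. -/
lemma exists_weak_limit {H : Type*} [NormedAddCommGroup H] [InnerProductSpace ℂ H]
    [CompleteSpace H] [TopologicalSpace.SeparableSpace H] {f : ℕ → H} (hf : ∀ n, ‖f n‖ ≤ 1) :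
    ∃ (g : H) (s : ℕ → ℕ), ‖g‖ ≤ 1 ∧ StrictMono s ∧
      ∀ k : H, Tendsto (fun n => (inner ℂ k (f (s n)) : ℂ)) atTop (𝓝 (inner ℂ k g)) := by
  have hmem : ∀ n, StrongDual.toWeakDual (InnerProductSpace.toDual ℂ H (f n)) ∈
      WeakDual.toStrongDual ⁻¹' Metric.closedBall (0 : StrongDual ℂ H) 1 := fun n => by
    rw [mem_preimage, mem_closedBall_zero_iff]
    exact ((InnerProductSpace.toDual ℂ H).norm_map (f n)).trans_le (hf n)
  obtain ⟨a, ha, s, hs, hlim⟩ := WeakDual.isSeqCompact_closedBall ℂ H 0 1 hmem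
  refine ⟨(InnerProductSpace.toDual ℂ H).symm (WeakDual.toStrongDual a), s, ?_, hs, fun k => ?_⟩
  · rw [LinearIsometryEquiv.norm_map]
    simpa using ha
  · have h1 := ((WeakDual.eval_continuous k).tendsto a).comp hlim
    have h2 := (Complex.continuous_conj.tendsto _).comp h1
    have e1 : ∀ n, (starRingEnd ℂ) ((StrongDual.toWeakDual
        (InnerProductSpace.toDual ℂ H (f (s n)))) k) = inner ℂ k (f (s n)) := fun n => by
      rw [← inner_conj_symm]; rfl
    have e2 : (starRingEnd ℂ) (a k) =
        inner ℂ k ((InnerProductSpace.toDual ℂ H).symm (WeakDual.toStrongDual a)) := by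
      rw [← inner_conj_symm, InnerProductSpace.toDual_symm_apply]; rfl
    rw [← e2]
    exact h2.congr e1

/-- Time- and band-limiting to sets of finite measure is a strict contraction of `L²`. -/
theorem exists_norm_cutoff_fourier_cutoff_le [Nontrivial V] {S F : Set V} (hS : MeasurableSet S)
    (hSfin : volume S ≠ ∞) (hF : MeasurableSet F) (hFfin : volume F ≠ ∞) :
    ∃ q : ℝ, 0 ≤ q ∧ q < 1 ∧ ∀ f : Lp ℂ 2 (volume : Measure V),
      ‖cutoff volume hF (𝓕 (cutoff volume hS f))‖ ≤ q * ‖f‖ := by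
  by_contra! hcon
  have h1 : ∀ n : ℕ, ∃ f : Lp ℂ 2 (volume : Measure V), ‖f‖ = 1 ∧
      1 - 1 / ((n : ℝ) + 1) < ‖cutoff volume hF (𝓕 (cutoff volume hS f))‖ := fun n => by
    have hn : (0 : ℝ) < n + 1 := by positivity
    obtain ⟨f, hf⟩ := hcon (1 - 1 / ((n : ℝ) + 1))
      (by rw [sub_nonneg, div_le_one hn]; linarith [(Nat.cast_nonneg n : (0 : ℝ) ≤ n)])
      (by have : 0 < 1 / ((n : ℝ) + 1) := by positivity
          linarith)
    have hf0 : f ≠ 0 := by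
      rintro rfl
      have h0 : (𝓕 (0 : Lp ℂ 2 (volume : Measure V)) : Lp ℂ 2 (volume : Measure V)) = 0 :=
        (Lp.fourierTransformₗᵢ V ℂ).map_zero
      simp [h0] at hf
    have hpos : 0 < ‖f‖ := norm_pos_iff.2 hf0
    refine ⟨((‖f‖⁻¹ : ℝ) : ℂ) • f, ?_, ?_⟩
    · rw [norm_smul, Complex.norm_real, norm_inv, norm_norm, inv_mul_cancel₀ hpos.ne']
    · rw [map_smul, FourierTransform.fourier_smul, map_smul, norm_smul, Complex.norm_real,
        norm_inv, norm_norm, lt_inv_mul_iff₀ hpos, mul_comm]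
      exact hf
  choose f hf1 hf2 using h1
  have : Fact ((2 : ℝ≥0∞) ≠ ∞) := ⟨by norm_num⟩
  obtain ⟨g, s, hg, hs, hweak⟩ := exists_weak_limit fun n => (hf1 n).le
  have hlim := tendsto_norm_cutoff_fourier_cutoff hS hSfin hF hFfin
    (fun n => (hf1 (s n)).le) hweak
  have hle : ∀ f : Lp ℂ 2 (volume : Measure V),
      ‖cutoff volume hF (𝓕 (cutoff volume hS f))‖ ≤ ‖cutoff volume hS f‖ := fun f =>
    (norm_cutoff_le hF _).trans_eq (Lp.norm_fourier_eq _)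
  -- the weak limit of normalized almost maximizers is a maximizer, so both cutoffs fix it
  have hge : 1 ≤ ‖cutoff volume hF (𝓕 (cutoff volume hS g))‖ ^ 2 := by
    have h0 : Tendsto (fun n : ℕ => (1 - 1 / (((s n : ℕ) : ℝ) + 1)) ^ 2) atTop (𝓝 1) := by
      have := ((tendsto_one_div_add_atTop_nhds_zero_nat (𝕜 := ℝ)).comp hs.tendsto_atTop)
      simpa using (this.const_sub 1).pow 2
    refine le_of_tendsto_of_tendsto' h0 hlim fun n => ?_
    refine pow_le_pow_left₀ ?_ (hf2 (s n)).le 2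
    have hn : (0 : ℝ) < (s n : ℝ) + 1 := by positivity
    rw [sub_nonneg, div_le_one hn]
    linarith [(Nat.cast_nonneg (s n) : (0 : ℝ) ≤ s n)]
  have hge' : 1 ≤ ‖cutoff volume hF (𝓕 (cutoff volume hS g))‖ := by
    nlinarith [norm_nonneg (cutoff volume hF (𝓕 (cutoff volume hS g)))]
  have e1 : cutoff volume hS g = g := cutoff_eq_self_of_norm_eq hS
    (le_antisymm (norm_cutoff_le hS g) (hg.trans (hge'.trans (hle g))))
  have e2 : cutoff volume hF (𝓕 g) = 𝓕 g := cutoff_eq_self_of_norm_eq hF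
    (le_antisymm (norm_cutoff_le hF _) (by
      rw [Lp.norm_fourier_eq]; rw [e1] at hge'; exact hg.trans hge'))
  have hg0 : g ∈ timeBandLimited hS hF := ⟨e1, e2⟩
  rw [timeBandLimited_eq_bot hS hSfin hF hFfin, Submodule.mem_bot] at hg0
  have := (hge'.trans (hle g)).trans (norm_cutoff_le hS g)
  rw [hg0, norm_zero] at this
  linarith

/-- The **Amrein–Berthier inequality**: the `L²` norm of a function is controlled by its mass off a
set of finite measure and the mass of its Fourier transform off another such set. -/
theorem amrein_berthier [Nontrivial V] {S F : Set V} (hS : MeasurableSet S)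
    (hSfin : volume S ≠ ∞) (hF : MeasurableSet F) (hFfin : volume F ≠ ∞) :
    ∃ C : ℝ, 0 < C ∧ ∀ f : Lp ℂ 2 (volume : Measure V),
      ‖f‖ ^ 2 ≤ C * ((∫ x in Sᶜ, ‖f x‖ ^ 2) +
        ∫ ξ in Fᶜ, ‖(𝓕 f : Lp ℂ 2 (volume : Measure V)) ξ‖ ^ 2) := by
  obtain ⟨q, hq0, hq1, hq⟩ := exists_norm_cutoff_fourier_cutoff_le hS hSfin hF hFfin
  have hq' : 0 < 1 - q := by linarith
  refine ⟨2 / (1 - q) ^ 2, by positivity, fun f => ?_⟩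
  rw [← norm_cutoff_sq hS.compl, ← norm_cutoff_sq hF.compl]
  set a := ‖cutoff volume hS.compl f‖
  set b := ‖cutoff volume hF.compl (𝓕 f)‖
  have h1 : ‖cutoff volume hF (𝓕 f)‖ ≤ q * ‖f‖ + a := by
    have : cutoff volume hF (𝓕 f) = cutoff volume hF (𝓕 (cutoff volume hS f)) +
        cutoff volume hF (𝓕 (cutoff volume hS.compl f)) := by
      rw [← map_add, ← FourierTransform.fourier_add, cutoff_add_compl]
    rw [this]
    refine (norm_add_le _ _).trans (add_le_add (hq f) ?_)
    exact (norm_cutoff_le hF _).trans_eq (Lp.norm_fourier_eq _)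
  have h2 : ‖f‖ ≤ q * ‖f‖ + a + b := by
    calc ‖f‖ = ‖cutoff volume hF (𝓕 f) + cutoff volume hF.compl (𝓕 f)‖ := by
          rw [cutoff_add_compl, Lp.norm_fourier_eq]
      _ ≤ _ := (norm_add_le _ _).trans (add_le_add_left h1 _)
  have h3 : (1 - q) * ‖f‖ ≤ a + b := by linarith
  have h4 : ((1 - q) * ‖f‖) ^ 2 ≤ (a + b) ^ 2 :=
    pow_le_pow_left₀ (by positivity) h3 2
  rw [div_mul_eq_mul_div, le_div_iff₀ (by positivity)]
  nlinarith [sq_nonneg (a - b)]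

end Uncertainty

/-! ### Gaussians as Schwartz functions -/

section GaussianSchwartz

lemma exists_norm_iteratedFDeriv_cexp_le (n : ℕ) :
    ∃ C : ℝ, 0 ≤ C ∧ ∀ z : ℂ, ‖iteratedFDeriv ℝ n Complex.exp z‖ ≤ C * Real.exp z.re := by
  refine ⟨‖iteratedFDeriv ℝ n Complex.exp 0‖, norm_nonneg _, fun z => ?_⟩
  have hfun : Complex.exp = Complex.exp z • fun w => Complex.exp (w - z) := by
    ext w
    rw [Pi.smul_apply, smul_eq_mul, ← Complex.exp_add]
    congr 1; ring
  have hsm : ContDiff ℝ n fun w : ℂ => Complex.exp (w - z) :=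
    Complex.contDiff_exp.comp (contDiff_id.sub contDiff_const)
  have : iteratedFDeriv ℝ n Complex.exp z =
      Complex.exp z • iteratedFDeriv ℝ n Complex.exp 0 := by
    conv_lhs => rw [hfun]
    rw [iteratedFDeriv_const_smul_apply hsm.contDiffAt, iteratedFDeriv_comp_sub, sub_self]
  rw [this, norm_smul, Complex.norm_exp, mul_comm]

lemma exists_one_add_pow_mul_exp_le (N : ℕ) {δ : ℝ} (hδ : 0 < δ) :
    ∃ C : ℝ, 0 ≤ C ∧ ∀ r : ℝ, 0 ≤ r → (1 + r) ^ N * Real.exp (-δ * r ^ 2) ≤ C := by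
  refine ⟨N.factorial * Real.exp (1 + 1 / (4 * δ)), by positivity, fun r hr => ?_⟩
  have h1 : (1 + r) ^ N ≤ N.factorial * Real.exp (1 + r) := by
    have := Real.pow_div_factorial_le_exp (1 + r) (by positivity) N
    rw [div_le_iff₀ (by positivity)] at this
    linarith
  calc (1 + r) ^ N * Real.exp (-δ * r ^ 2)
      ≤ N.factorial * Real.exp (1 + r) * Real.exp (-δ * r ^ 2) :=
        mul_le_mul_of_nonneg_right h1 (Real.exp_pos _).le
    _ = N.factorial * Real.exp (1 + r + -δ * r ^ 2) := by rw [mul_assoc, ← Real.exp_add]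
    _ ≤ _ := by
        refine mul_le_mul_of_nonneg_left (Real.exp_le_exp.2 ?_) (by positivity)
        have h : 1 / (4 * δ) - r + δ * r ^ 2 = δ * (r - 1 / (2 * δ)) ^ 2 := by
          field_simp
          ring
        nlinarith [mul_nonneg hδ.le (sq_nonneg (r - 1 / (2 * δ)))]

variable {V : Type*} [NormedAddCommGroup V] [InnerProductSpace ℝ V]

/-- The exponential of a smooth function of temperate growth whose real part is bounded above by a
negative definite quadratic form, as a Schwartz function. -/
noncomputable def expSchwartz (q : V → ℂ) (hq : q.HasTemperateGrowth) {δ M : ℝ} (hδ : 0 < δ)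
    (hre : ∀ x, (q x).re ≤ M - δ * ‖x‖ ^ 2) : 𝓢(V, ℂ) where
  toFun x := Complex.exp (q x)
  smooth' := Complex.contDiff_exp.comp hq.1
  decay' k n := by
    obtain ⟨l, D, hD0, hD⟩ := hq.norm_iteratedFDeriv_le_uniform n
    choose E hE0 hE using exists_norm_iteratedFDeriv_cexp_le
    set E' := ∑ i ∈ Finset.range (n + 1), E i
    have hE' : ∀ i ≤ n, E i ≤ E' := fun i hi =>
      Finset.single_le_sum (fun j _ => hE0 j) (Finset.mem_range.2 (Nat.lt_succ_of_le hi))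
    have hE'0 : 0 ≤ E' := Finset.sum_nonneg fun j _ => hE0 j
    obtain ⟨C, hC0, hC⟩ := exists_one_add_pow_mul_exp_le (k + l * n) hδ
    refine ⟨n.factorial * E' * Real.exp M * (1 + D) ^ n * C, fun x => ?_⟩
    have hx1 : (1 : ℝ) ≤ 1 + ‖x‖ := by linarith [norm_nonneg x]
    have hb1 : ∀ i ≤ n, ‖iteratedFDeriv ℝ i Complex.exp (q x)‖ ≤
        E' * Real.exp (q x).re := fun i hi =>
      (hE i (q x)).trans (mul_le_mul_of_nonneg_right (hE' i hi) (Real.exp_pos _).le)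
    have hb2 : ∀ i, 1 ≤ i → i ≤ n →
        ‖iteratedFDeriv ℝ i q x‖ ≤ ((1 + D) * (1 + ‖x‖) ^ l) ^ i := fun i hi1 hi => by
      have h1 : (1 : ℝ) ≤ (1 + D) * (1 + ‖x‖) ^ l :=
        one_le_mul_of_one_le_of_one_le (by linarith) (one_le_pow₀ hx1)
      refine (hD i hi x).trans (le_trans ?_ (le_self_pow₀ h1 (by omega)))
      exact mul_le_mul_of_nonneg_right (by linarith) (by positivity)
    have h := norm_iteratedFDeriv_comp_le (n := n) (N := (⊤ : ℕ∞))
      (Complex.contDiff_exp (𝕜 := ℝ)) hq.1 (by exact_mod_cast le_top) x hb1 hb2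
    have hre' : Real.exp (q x).re ≤ Real.exp M * Real.exp (-δ * ‖x‖ ^ 2) := by
      rw [← Real.exp_add]
      exact Real.exp_le_exp.2 (by linarith [hre x])
    have hxk : ‖x‖ ^ k ≤ (1 + ‖x‖) ^ k :=
      pow_le_pow_left₀ (norm_nonneg x) (by linarith) k
    calc ‖x‖ ^ k * ‖iteratedFDeriv ℝ n (fun x => Complex.exp (q x)) x‖
        ≤ (1 + ‖x‖) ^ k * (n.factorial * (E' * (Real.exp M * Real.exp (-δ * ‖x‖ ^ 2))) *
            ((1 + D) * (1 + ‖x‖) ^ l) ^ n) := by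
          refine mul_le_mul hxk (h.trans ?_) (norm_nonneg _) (by positivity)
          gcongr
      _ = n.factorial * E' * Real.exp M * (1 + D) ^ n *
            ((1 + ‖x‖) ^ (k + l * n) * Real.exp (-δ * ‖x‖ ^ 2)) := by
          rw [mul_pow, ← pow_mul, pow_add]; ring
      _ ≤ _ := mul_le_mul_of_nonneg_left (hC _ (norm_nonneg x)) (by positivity)

lemma re_neg_mul_sq_add_le {a : ℂ} (ha : 0 < a.re) (ℓ : V →L[ℝ] ℂ) (x : V) :
    (-a * (‖x‖ : ℂ) ^ 2 + ℓ x).re ≤ ‖ℓ‖ ^ 2 / (2 * a.re) - a.re / 2 * ‖x‖ ^ 2 := by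
  have h1 : (ℓ x).re ≤ ‖ℓ‖ * ‖x‖ := (Complex.re_le_norm _).trans (ℓ.le_opNorm x)
  have h2 : (-a * (‖x‖ : ℂ) ^ 2).re = -a.re * ‖x‖ ^ 2 := by
    rw [← Complex.ofReal_pow, Complex.re_mul_ofReal, Complex.neg_re]
  have h3 : ‖ℓ‖ ^ 2 / (2 * a.re) - a.re / 2 * ‖x‖ ^ 2 - (-a.re * ‖x‖ ^ 2 + ‖ℓ‖ * ‖x‖) =
      a.re / 2 * (‖x‖ - ‖ℓ‖ / a.re) ^ 2 := by
    field_simp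
    ring
  rw [Complex.add_re, h2]
  nlinarith [mul_nonneg (half_pos ha).le (sq_nonneg (‖x‖ - ‖ℓ‖ / a.re))]

/-- The Gaussian `x ↦ exp (-a ‖x‖² + ℓ x)` with `Re a > 0` and a real-linear `ℓ`, as a Schwartz
function. -/
noncomputable def gaussianSchwartz {a : ℂ} (ha : 0 < a.re) (ℓ : V →L[ℝ] ℂ) : 𝓢(V, ℂ) :=
  expSchwartz (fun x => -a * (‖x‖ : ℂ) ^ 2 + ℓ x)
    (by
      have h1 : (fun x : V => ((‖x‖ ^ 2 : ℝ) : ℂ)).HasTemperateGrowth :=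
        Complex.ofRealCLM.hasTemperateGrowth.comp (Function.hasTemperateGrowth_norm_sq V)
      have h2 := ((Function.HasTemperateGrowth.const (E := V) (-a)).mul h1).add
        ℓ.hasTemperateGrowth
      have h3 : (fun x : V => -a * (‖x‖ : ℂ) ^ 2 + ℓ x) =
          (fun _ => -a) * (fun x : V => ((‖x‖ ^ 2 : ℝ) : ℂ)) + ⇑ℓ := by
        funext x
        simp
      rwa [h3])
    (half_pos ha) (re_neg_mul_sq_add_le ha ℓ)

lemma gaussianSchwartz_apply {a : ℂ} (ha : 0 < a.re) (ℓ : V →L[ℝ] ℂ) (x : V) :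
    gaussianSchwartz ha ℓ x = Complex.exp (-a * (‖x‖ : ℂ) ^ 2 + ℓ x) := rfl

end GaussianSchwartz

/-! ### Gaussian integrals and totality of Gaussians -/

section GaussianIntegral

variable {V : Type*} [NormedAddCommGroup V] [InnerProductSpace ℝ V] [FiniteDimensional ℝ V]
  [MeasurableSpace V] [BorelSpace V]

/-- The integral of a Gaussian with a complex-valued real-linear term in the exponent. -/
lemma integral_cexp_neg_mul_sq_norm_add_clm {ι : Type*} [Fintype ι] (e : OrthonormalBasis ι ℝ V)
    {a : ℂ} (ha : 0 < a.re) (ℓ : V →L[ℝ] ℂ) :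
    ∫ v, Complex.exp (-a * (‖v‖ : ℂ) ^ 2 + ℓ v) =
      (Real.pi / a) ^ (Fintype.card ι / 2 : ℂ) *
        Complex.exp ((∑ i, ℓ (e i) ^ 2) / (4 * a)) := by
  rw [← GaussianFourier.integral_cexp_neg_mul_sum_add ha,
    ← e.measurePreserving_repr_symm.integral_comp
      e.repr.symm.toHomeomorph.measurableEmbedding,
    ← (PiLp.volume_preserving_toLp ι).integral_comp
      (MeasurableEquiv.toLp 2 _).measurableEmbedding]
  congr 1
  ext v
  have h1 : ‖e.repr.symm (WithLp.toLp 2 v)‖ ^ 2 = ∑ i, v i ^ 2 := by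
    rw [LinearIsometryEquiv.norm_map, EuclideanSpace.real_norm_sq_eq]
  have h2 : ℓ (e.repr.symm (WithLp.toLp 2 v)) = ∑ i, ℓ (e i) * v i := by
    rw [← e.sum_repr_symm, map_sum]
    refine Finset.sum_congr rfl fun i _ => ?_
    rw [map_smul, Complex.real_smul, mul_comm]
  rw [← Complex.ofReal_pow, h1, h2]
  push_cast
  rfl

/-- Gaussian multiples of characters are total in `L²`: the pairings of `f` with them are the values
of the Fourier transform of `f` times a positive Gaussian. -/
lemma eq_zero_of_integral_mul_gaussian_char {κ : ℝ} (hκ : 0 < κ)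
    (f : Lp ℂ 2 (volume : Measure V))
    (h : ∀ ξ : V, ∫ x, f x * conj (Complex.exp (-(κ : ℂ) * (‖x‖ : ℂ) ^ 2 +
      2 * Real.pi * Complex.I * (inner ℝ x ξ : ℝ))) = 0) : f = 0 := by
  set G : 𝓢(V, ℂ) := gaussianSchwartz (a := (κ : ℂ)) (by simpa using hκ) 0 with hGdef
  have hG : ∀ x, G x = ((Real.exp (-κ * ‖x‖ ^ 2) : ℝ) : ℂ) := fun x => by
    rw [hGdef, gaussianSchwartz_apply]
    simp
  have hint : Integrable fun x => f x * G x := (Lp.memLp f).integrable_mul (G.memLp 2)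
  have hL2 : MemLp (fun x => f x * G x) 2 volume :=
    (G.memLp ⊤).mul' (Lp.memLp f)
  have hFour : 𝓕 (fun x => f x * G x) = 0 := by
    ext ξ
    rw [Real.fourier_eq', Pi.zero_apply, ← h ξ]
    congr 1; ext x
    rw [hG, ← Complex.exp_conj, smul_eq_mul, Complex.ofReal_exp]
    simp only [map_add, map_mul, map_neg, map_pow, Complex.conj_ofReal, Complex.conj_I, map_ofNat]
    rw [mul_left_comm, ← Complex.exp_add]
    congr 2
    push_cast
    ring
  have h0 := fourier_toLp_ae_eq hint hL2
  rw [hFour] at h0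
  have h1 : (𝓕 (hL2.toLp _) : Lp ℂ 2 (volume : Measure V)) = 0 :=
    Lp.ext (h0.trans (Lp.coeFn_zero ℂ 2 volume).symm)
  have h2 : ‖hL2.toLp (fun x => f x * G x)‖ = 0 := by
    rw [← Lp.norm_fourier_eq, h1, norm_zero]
  rw [norm_eq_zero] at h2
  refine Lp.ext ?_
  filter_upwards [hL2.coeFn_toLp, Lp.coeFn_zero ℂ 2 (volume : Measure V)] with x hx hx0
  rw [h2, hx0, Pi.zero_apply] at hx
  rw [hx0, Pi.zero_apply]
  refine (mul_eq_zero.1 hx.symm).resolve_right ?_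
  rw [hG]
  exact_mod_cast (Real.exp_pos _).ne'

end GaussianIntegral

/-! ### Powers of affine functions times Gaussians -/

section PolyGauss

variable {V : Type*} [NormedAddCommGroup V] [InnerProductSpace ℝ V]

/-- The function `x ↦ (L x + ρ)ⁿ exp (-κ ‖x‖² + ℓ x)`: a power of an affine function times a
Gaussian. -/
noncomputable def polyGauss (κ : ℝ) (L : V →L[ℝ] ℂ) (ρ : ℂ) (ℓ : V →L[ℝ] ℂ) (n : ℕ) (x : V) : ℂ :=
  (L x + ρ) ^ n * Complex.exp (-(κ : ℂ) * (‖x‖ : ℂ) ^ 2 + ℓ x)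

variable (κ : ℝ) (L : V →L[ℝ] ℂ) (ρ : ℂ) (ℓ : V →L[ℝ] ℂ)

lemma hasFDerivAt_polyGauss (n : ℕ) (x : V) :
    HasFDerivAt (polyGauss κ L ρ ℓ n)
      ((n * polyGauss κ L ρ ℓ (n - 1) x) • L +
        polyGauss κ L ρ ℓ n x •
          ((-2 * κ : ℂ) • (Complex.ofRealCLM.comp (innerSL ℝ x)) + ℓ)) x := by
  have h1 : HasFDerivAt (fun x => (L x + ρ) ^ n) ((n * (L x + ρ) ^ (n - 1)) • L) x := by
    simpa using (L.hasFDerivAt.add_const ρ).pow n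
  have h2 : HasFDerivAt (fun x : V => (‖x‖ : ℂ) ^ 2)
      ((2 : ℂ) • (Complex.ofRealCLM.comp (innerSL ℝ x))) x := by
    have h := (Complex.ofRealCLM.hasFDerivAt.comp x
      (hasStrictFDerivAt_norm_sq x).hasFDerivAt).congr_fderiv
      (g' := (2 : ℂ) • (Complex.ofRealCLM.comp (innerSL ℝ x))) (by ext y; simp)
    refine h.congr_of_eventuallyEq (Eventually.of_forall fun y => ?_)
    simp
  have h3 := ((h2.const_mul (-(κ : ℂ))).fun_add ℓ.hasFDerivAt).cexp
  refine (h1.fun_mul h3).congr_fderiv ?_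
  ext y
  simp [polyGauss]
  ring

lemma fderiv_polyGauss (n : ℕ) (x v : V) :
    fderiv ℝ (polyGauss κ L ρ ℓ n) x v =
      n * L v * polyGauss κ L ρ ℓ (n - 1) x +
        (-2 * κ * (inner ℝ x v : ℝ) + ℓ v) * polyGauss κ L ρ ℓ n x := by
  rw [(hasFDerivAt_polyGauss κ L ρ ℓ n x).fderiv]
  simp
  ring

lemma fderiv_fderiv_polyGauss (n : ℕ) (x v : V) :
    fderiv ℝ (fun y => fderiv ℝ (polyGauss κ L ρ ℓ n) y v) x v =
      n * L v * fderiv ℝ (polyGauss κ L ρ ℓ (n - 1)) x v +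
        (-2 * κ * ((‖v‖ ^ 2 : ℝ) : ℂ)) * polyGauss κ L ρ ℓ n x +
        (-2 * κ * (inner ℝ x v : ℝ) + ℓ v) * fderiv ℝ (polyGauss κ L ρ ℓ n) x v := by
  simp_rw [fderiv_polyGauss κ L ρ ℓ n]
  have h1 : HasFDerivAt (fun y : V => -2 * (κ : ℂ) * (inner ℝ y v : ℝ) + ℓ v)
      ((-2 * κ : ℂ) • (Complex.ofRealCLM.comp (innerSL ℝ v))) x := by
    have h := ((Complex.ofRealCLM.comp (innerSL ℝ v)).hasFDerivAt (x := x)).const_mul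
      (-2 * κ : ℂ) |>.add_const (ℓ v)
    refine h.congr_of_eventuallyEq (Eventually.of_forall fun y => ?_)
    simp [real_inner_comm]
  have h := ((hasFDerivAt_polyGauss κ L ρ ℓ (n - 1) x).const_mul (n * L v)).add
    (h1.mul (hasFDerivAt_polyGauss κ L ρ ℓ n x))
  have h' : fderiv ℝ (fun y => n * L v * polyGauss κ L ρ ℓ (n - 1) y +
      (-2 * κ * (inner ℝ y v : ℝ) + ℓ v) * polyGauss κ L ρ ℓ n y) x = _ := h.fderiv
  rw [h', fderiv_polyGauss, ← fderiv_polyGauss κ L ρ ℓ n,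
    (hasFDerivAt_polyGauss κ L ρ ℓ n x).fderiv]
  simp
  ring

lemma hasTemperateGrowth_pow_affine (n : ℕ) :
    (fun x : V => (L x + ρ) ^ n).HasTemperateGrowth :=
  (L.hasTemperateGrowth.add (Function.HasTemperateGrowth.const ρ)).pow n

/-- `polyGauss` as a Schwartz function. -/
noncomputable def polyGaussSchwartz {κ : ℝ} (hκ : 0 < κ) (L : V →L[ℝ] ℂ) (ρ : ℂ) (ℓ : V →L[ℝ] ℂ)
    (n : ℕ) : 𝓢(V, ℂ) :=
  SchwartzMap.smulLeftCLM ℂ (fun x => (L x + ρ) ^ n)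
    (gaussianSchwartz (a := (κ : ℂ)) (by simpa using hκ) ℓ)

lemma coe_polyGaussSchwartz {κ : ℝ} (hκ : 0 < κ) (n : ℕ) :
    ⇑(polyGaussSchwartz hκ L ρ ℓ n) = polyGauss κ L ρ ℓ n := by
  ext x
  rw [polyGaussSchwartz, SchwartzMap.smulLeftCLM_apply_apply
    (hasTemperateGrowth_pow_affine L ρ n)]
  rfl

end PolyGauss

/-! ### Eigenfunctions of the special Hermite operator -/

section SpecialHermite

variable {d : ℕ}

/-- The real-linear functional `z ↦ ∑ⱼ (αⱼ xⱼ + βⱼ yⱼ)` on `ℂ^d`, with `zⱼ = xⱼ + i yⱼ` and complex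
coefficients. -/
noncomputable def realLin (α β : Fin d → ℂ) : Cd d →L[ℝ] ℂ :=
  ∑ j, ((α j) • (Complex.ofRealCLM.comp
      (Complex.reCLM.comp (PiLp.proj (𝕜 := ℝ) 2 (fun _ : Fin d => ℂ) j))) +
    (β j) • (Complex.ofRealCLM.comp
      (Complex.imCLM.comp (PiLp.proj (𝕜 := ℝ) 2 (fun _ : Fin d => ℂ) j))))

lemma realLin_apply (α β : Fin d → ℂ) (z : Cd d) :
    realLin α β z = ∑ j, (α j * ((z j).re : ℂ) + β j * ((z j).im : ℂ)) := by
  simp [realLin]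

lemma realLin_single_one (α β : Fin d → ℂ) (j : Fin d) :
    realLin α β (EuclideanSpace.single j (1 : ℂ)) = α j := by
  rw [realLin_apply, Finset.sum_eq_single j]
  · simp
  · intro k _ hk; simp [hk]
  · simp

lemma realLin_single_I (α β : Fin d → ℂ) (j : Fin d) :
    realLin α β (EuclideanSpace.single j Complex.I) = β j := by
  rw [realLin_apply, Finset.sum_eq_single j]
  · simp
  · intro k _ hk; simp [hk]
  · simp

lemma real_inner_eq_sum (z w : Cd d) :
    (inner ℝ z w : ℝ) = ∑ j, ((z j).re * (w j).re + (z j).im * (w j).im) := by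
  rw [PiLp.inner_apply]
  refine Finset.sum_congr rfl fun j _ => ?_
  rw [Complex.inner]
  simp
  ring

lemma real_inner_single_one (z : Cd d) (j : Fin d) :
    (inner ℝ z (EuclideanSpace.single j (1 : ℂ)) : ℝ) = (z j).re := by
  rw [real_inner_eq_sum, Finset.sum_eq_single j]
  · simp
  · intro k _ hk; simp [hk]
  · simp

lemma real_inner_single_I (z : Cd d) (j : Fin d) :
    (inner ℝ z (EuclideanSpace.single j Complex.I) : ℝ) = (z j).im := by
  rw [real_inner_eq_sum, Finset.sum_eq_single j]
  · simp
  · intro k _ hk; simp [hk]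
  · simp

lemma norm_sq_Cd (z : Cd d) : ‖z‖ ^ 2 = ∑ j, ((z j).re ^ 2 + (z j).im ^ 2) := by
  rw [← real_inner_self_eq_norm_sq, real_inner_eq_sum]
  simp only [sq]

lemma norm_sq_Cd_cast (z : Cd d) :
    (‖z‖ : ℂ) ^ 2 = ∑ j, (((z j).re : ℂ) ^ 2 + ((z j).im : ℂ) ^ 2) := by
  exact_mod_cast congrArg ((↑) : ℝ → ℂ) (norm_sq_Cd z)

/-- For `ε = ±1` and `lam = 4κε`, the functions
`(b·z + ρ)ⁿ exp (c·z̄ - κ‖z‖²)` with `ρ = -(b·c)/(2κ)`, where for `ε = -1` the roles of `z` and `z̄`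
are exchanged, are eigenfunctions of the special Hermite operator. -/
lemma specialHermite_polyGauss {κ ε : ℝ} (hκ : κ ≠ 0) (hε : ε ^ 2 = 1) (b c : Fin d → ℂ)
    (n : ℕ) (z : Cd d) :
    specialHermite (4 * κ * ε)
      (polyGauss κ (realLin b fun j => Complex.I * ε * b j) (-(∑ j, b j * c j) / (2 * κ))
        (realLin c fun j => -(Complex.I * ε * c j)) n) z =
      ((4 * κ * (2 * n + d) : ℝ) : ℂ) *
        polyGauss κ (realLin b fun j => Complex.I * ε * b j) (-(∑ j, b j * c j) / (2 * κ))
          (realLin c fun j => -(Complex.I * ε * c j)) n z := by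
  set L := realLin b fun j => Complex.I * ε * b j with hL
  set ℓ := realLin c fun j => -(Complex.I * ε * c j) with hℓ
  set ρ : ℂ := -(∑ j, b j * c j) / (2 * κ) with hρ
  have hεC : (ε : ℂ) ^ 2 = 1 := by exact_mod_cast hε
  have hκC : (κ : ℂ) ≠ 0 := by exact_mod_cast hκ
  have hI : Complex.I ^ 2 = -1 := Complex.I_sq
  set P := polyGauss κ L ρ ℓ n z with hP
  set Q := polyGauss κ L ρ ℓ (n - 1) z with hQ
  have hX : ∀ j, partialX j (polyGauss κ L ρ ℓ n) z =
      n * b j * Q + (-2 * κ * (z j).re + c j) * P := fun j => by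
    rw [partialX, fderiv_polyGauss, real_inner_single_one, hL, hℓ, realLin_single_one,
      realLin_single_one]
  have hY : ∀ j, partialY j (polyGauss κ L ρ ℓ n) z =
      n * (Complex.I * ε * b j) * Q + (-2 * κ * (z j).im + -(Complex.I * ε * c j)) * P :=
    fun j => by
    rw [partialY, fderiv_polyGauss, real_inner_single_I, hL, hℓ, realLin_single_I,
      realLin_single_I]
  have hΔ : ∀ j, partialX j (partialX j (polyGauss κ L ρ ℓ n)) z +
      partialY j (partialY j (polyGauss κ L ρ ℓ n)) z =
      (-4 * κ * n * Q) * (b j * (z j).re + Complex.I * ε * b j * (z j).im) +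
      (4 * n * Q) * (b j * c j) - 4 * κ * P +
      (4 * κ ^ 2 * P) * (((z j).re : ℂ) ^ 2 + ((z j).im : ℂ) ^ 2) -
      (4 * κ * P) * (c j * (z j).re + -(Complex.I * ε * c j) * (z j).im) := fun j => by
    have e1 : partialX j (partialX j (polyGauss κ L ρ ℓ n)) z = _ :=
      fderiv_fderiv_polyGauss κ L ρ ℓ n z (EuclideanSpace.single j (1 : ℂ))
    have e2 : partialY j (partialY j (polyGauss κ L ρ ℓ n)) z = _ :=
      fderiv_fderiv_polyGauss κ L ρ ℓ n z (EuclideanSpace.single j Complex.I)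
    rw [e1, e2]
    simp only [fderiv_polyGauss, real_inner_single_I, real_inner_single_one, hL, hℓ,
      realLin_single_I, realLin_single_one, PiLp.norm_single, norm_one, Complex.norm_I,
      one_pow, Complex.ofReal_one, mul_one]
    simp only [← hL, ← hℓ, ← hP, ← hQ]
    linear_combination
      (n * b j * ((n - 1 : ℕ) * b j * polyGauss κ L ρ ℓ (n - 1 - 1) z) * ε ^ 2 -
        2 * n * b j * c j * Q * ε ^ 2 + c j ^ 2 * P * ε ^ 2) * hI +
      (-(n * b j * ((n - 1 : ℕ) * b j * polyGauss κ L ρ ℓ (n - 1 - 1) z)) +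
        2 * n * b j * c j * Q - c j ^ 2 * P) * hεC
  have hN : ∀ j, ((z j).re : ℂ) * partialY j (polyGauss κ L ρ ℓ n) z -
      ((z j).im : ℂ) * partialX j (polyGauss κ L ρ ℓ n) z =
      (Complex.I * ε * n * Q) * (b j * (z j).re + Complex.I * ε * b j * (z j).im) -
      (Complex.I * ε * P) * (c j * (z j).re + -(Complex.I * ε * c j) * (z j).im) := fun j => by
    rw [hX, hY]
    linear_combination
      (-(n * b j * (z j).im * Q) * ε ^ 2 - c j * (z j).im * P * ε ^ 2) * hI +
        (n * b j * (z j).im * Q + c j * (z j).im * P) * hεC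
  have hnorm := norm_sq_Cd_cast z
  have hLz : L z = ∑ j, (b j * (z j).re + Complex.I * ε * b j * (z j).im) := realLin_apply _ _ _
  have hℓz : ℓ z = ∑ j, (c j * (z j).re + -(Complex.I * ε * c j) * (z j).im) :=
    realLin_apply _ _ _
  have hB : ∑ j, b j * c j = -(2 * κ * ρ) := by
    rw [hρ]; field_simp
  -- at `n = 0` the truncated subtraction in `Q` is harmless because of the factor `n`
  have hrec : n * (L z + ρ) * Q = n * P := by
    rcases n with _ | m
    · simp
    · simp only [hP, hQ, polyGauss, Nat.add_sub_cancel, pow_succ]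
      ring
  have hlap : laplacianCd (polyGauss κ L ρ ℓ n) z =
      (-4 * κ * n * Q) * L z + (4 * n * Q) * (-(2 * κ * ρ)) - d * (4 * κ * P) +
      (4 * κ ^ 2 * P) * (‖z‖ : ℂ) ^ 2 - (4 * κ * P) * ℓ z := by
    rw [laplacianCd, Finset.sum_congr rfl fun j _ => hΔ j]
    simp only [Finset.sum_add_distrib, Finset.sum_sub_distrib, ← Finset.mul_sum]
    rw [Finset.sum_const, Finset.card_univ, Fintype.card_fin, nsmul_eq_mul, hB, hLz, hℓz, hnorm]
    simp only [Finset.sum_add_distrib]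
    ring
  have hrot : ∑ j, (((z j).re : ℂ) * partialY j (polyGauss κ L ρ ℓ n) z -
      ((z j).im : ℂ) * partialX j (polyGauss κ L ρ ℓ n) z) =
      (Complex.I * ε * n * Q) * L z - (Complex.I * ε * P) * ℓ z := by
    rw [Finset.sum_congr rfl fun j _ => hN j, Finset.sum_sub_distrib, ← Finset.mul_sum,
      ← Finset.mul_sum, hLz, hℓz]
  rw [specialHermite, hlap, hrot]
  push_cast
  linear_combination (8 * κ : ℂ) * hrec +
    (-4 * κ * ε ^ 2 * n * Q * L z + 4 * κ * ε ^ 2 * P * ℓ z) * hI +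
    (4 * κ ^ 2 * (‖z‖ : ℂ) ^ 2 * P + 4 * κ * n * Q * L z - 4 * κ * P * ℓ z) * hεC

end SpecialHermite

/-! ### Pairings of a solution with eigenfunctions and coherent states -/

section Pairing

lemma integral_mul_conj_eq_inner {V : Type*} [NormedAddCommGroup V] [InnerProductSpace ℝ V]
    [FiniteDimensional ℝ V] [MeasurableSpace V] [BorelSpace V]
    (f : Lp ℂ 2 (volume : Measure V)) {g : V → ℂ} (hg : MemLp g 2 volume) :
    ∫ x, f x * conj (g x) = inner ℂ (hg.toLp g) f := by
  rw [L2.inner_def]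
  refine integral_congr_ae ?_
  filter_upwards [hg.coeFn_toLp] with x hx
  rw [hx, RCLike.inner_apply]

/-- Pairing a solution with a Schwartz eigenfunction of the special Hermite operator gives an
exponential in time. -/
lemma IsSchrodingerSolution.pairing_eigenfunction {d : ℕ} {lam : ℝ}
    {u₀ : Lp ℂ 2 (volume : Measure (Cd d))} {u : ℝ → Lp ℂ 2 (volume : Measure (Cd d))}
    (hu : IsSchrodingerSolution lam u₀ u) (φ : 𝓢(Cd d, ℂ)) {μ : ℝ}
    (hφ : ∀ z, specialHermite lam φ z = μ * φ z) {t : ℝ} (ht : 0 < t) :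
    ∫ z, (u t) z * conj (φ z) =
      Complex.exp (-(Complex.I * μ * t)) * ∫ z, u₀ z * conj (φ z) := by
  set F : ℝ → ℂ := fun s => ∫ z, (u s) z * conj (φ z) with hF
  have hFinner : ∀ s, F s = inner ℂ ((φ.memLp 2).toLp φ) (u s) := fun s =>
    integral_mul_conj_eq_inner (u s) (φ.memLp 2)
  have hcont : ContinuousOn F (Ici 0) := by
    simp_rw [funext hFinner]
    exact continuousOn_const.inner hu.continuousOn
  have hderiv : ∀ s, 0 < s → HasDerivAt F (-(Complex.I * μ) * F s) s := fun s hs => by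
    obtain ⟨D, hD, hDeq⟩ := hu.equation φ s hs
    have h1 : ∫ z, (u s) z * conj (specialHermite lam (φ : Cd d → ℂ) z) = μ * F s := by
      rw [hF, ← integral_const_mul]
      congr 1; ext z
      rw [hφ z, map_mul, Complex.conj_ofReal]; ring
    rw [h1] at hDeq
    have : D = -(Complex.I * μ) * F s := by
      linear_combination -Complex.I * hDeq + D * Complex.I_sq
    rwa [← this]
  -- `s ↦ exp (iμs) F s` is constant on `(0, ∞)` and continuous at `0`
  set g : ℝ → ℂ := fun s => Complex.exp (Complex.I * μ * s) * F s with hg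
  have hgderiv : ∀ s, 0 < s → HasDerivAt g 0 s := fun s hs => by
    have h1 : HasDerivAt (fun s : ℝ => Complex.exp (Complex.I * μ * s))
        (Complex.exp (Complex.I * μ * s) * (Complex.I * μ)) s := by
      have := ((hasDerivAt_id s).ofReal_comp.const_mul (Complex.I * μ)).cexp
      simpa using this
    have h2 := h1.mul (hderiv s hs)
    refine h2.congr_deriv ?_
    ring
  have hgconst : ∀ s, 0 < s → g s = g t := fun s hs =>
    isOpen_Ioi.is_const_of_deriv_eq_zero (𝕜 := ℝ) isPreconnected_Ioi
      (fun r hr => (hgderiv r hr).differentiableAt.differentiableWithinAt)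
      (fun r hr => (hgderiv r hr).deriv) hs ht
  have hgcont : ContinuousWithinAt g (Ioi 0) 0 := by
    have h1 : ContinuousOn g (Ici 0) :=
      (Continuous.continuousOn (by fun_prop)).mul hcont
    exact (h1 0 self_mem_Ici).mono Ioi_subset_Ici_self
  have hlim : Tendsto g (𝓝[>] 0) (𝓝 (g t)) :=
    tendsto_const_nhds.congr' (by
      filter_upwards [self_mem_nhdsWithin] with s hs
      exact (hgconst s hs).symm)
  have h0 : g 0 = g t := tendsto_nhds_unique hgcont hlim
  have h1 : F 0 = Complex.exp (Complex.I * μ * t) * F t := by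
    simpa [hg] using h0
  have h2 : F 0 = ∫ z, u₀ z * conj (φ z) := by simp only [hF, hu.initial]
  rw [← h2, h1, ← mul_assoc, ← Complex.exp_add]
  simp [hF]

variable {V : Type*} [NormedAddCommGroup V] [InnerProductSpace ℝ V] [FiniteDimensional ℝ V]
  [MeasurableSpace V] [BorelSpace V]

/-- Generating function: the pairings with the functions `polyGauss`, weighted by `w̄ⁿ / n!`, sum up
to the pairing with a Gaussian. -/
lemma hasSum_pairing_polyGauss {κ : ℝ} (hκ : 0 < κ) (L : V →L[ℝ] ℂ) (ρ : ℂ) (ℓ : V →L[ℝ] ℂ)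
    (w : ℂ) (f : Lp ℂ 2 (volume : Measure V)) :
    HasSum (fun n : ℕ => conj w ^ n / n.factorial * ∫ x, f x * conj (polyGauss κ L ρ ℓ n x))
      (∫ x, f x * conj (Complex.exp (w * (L x + ρ) + (-(κ : ℂ) * (‖x‖ : ℂ) ^ 2 + ℓ x)))) := by
  have hκ' : 0 < (κ : ℂ).re := by simpa using hκ
  set q : V → ℂ := fun x => -(κ : ℂ) * (‖x‖ : ℂ) ^ 2 + ℓ x with hq
  set E : V → ℝ := fun x => Real.exp (‖w * (L x + ρ)‖ + (q x).re) with hE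
  have hqc : Continuous q := by fun_prop
  have hEc : Continuous E := by fun_prop
  set M : ℝ := ‖w‖ * ‖ρ‖ + (‖w‖ * ‖L‖ + ‖ℓ‖) ^ 2 / (2 * κ)
  have hEle : ∀ x, ‖E x‖ ≤ Real.exp M *
      ‖gaussianSchwartz (a := ((κ / 2 : ℝ) : ℂ)) (by simpa using hκ) (0 : V →L[ℝ] ℂ) x‖ :=
    fun x => by
    rw [gaussianSchwartz_apply, Complex.norm_exp, Real.norm_of_nonneg (Real.exp_pos _).le,
      ← Real.exp_add]
    refine Real.exp_le_exp.2 ?_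
    have h1 : ‖w * (L x + ρ)‖ ≤ ‖w‖ * (‖L‖ * ‖x‖ + ‖ρ‖) := by
      rw [norm_mul]
      exact mul_le_mul_of_nonneg_left
        ((norm_add_le _ _).trans (add_le_add_left (L.le_opNorm x) _)) (norm_nonneg _)
    have h2 : (q x).re ≤ -κ * ‖x‖ ^ 2 + ‖ℓ‖ * ‖x‖ := by
      have h3 : (ℓ x).re ≤ ‖ℓ‖ * ‖x‖ := (Complex.re_le_norm _).trans (ℓ.le_opNorm x)
      have h4 : (-(κ : ℂ) * (‖x‖ : ℂ) ^ 2).re = -κ * ‖x‖ ^ 2 := by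
        rw [← Complex.ofReal_pow, Complex.re_mul_ofReal, Complex.neg_re, Complex.ofReal_re]
      rw [hq, Complex.add_re, h4]
      linarith
    have h5 : (-((κ / 2 : ℝ) : ℂ) * (‖x‖ : ℂ) ^ 2 + (0 : V →L[ℝ] ℂ) x).re =
        -(κ / 2) * ‖x‖ ^ 2 := by
      rw [zero_apply, add_zero, ← Complex.ofReal_pow, Complex.re_mul_ofReal,
        Complex.neg_re, Complex.ofReal_re]
    have h6 : M + -(κ / 2) * ‖x‖ ^ 2 -
        (‖w‖ * (‖L‖ * ‖x‖ + ‖ρ‖) + (-κ * ‖x‖ ^ 2 + ‖ℓ‖ * ‖x‖)) =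
        κ / 2 * (‖x‖ - (‖w‖ * ‖L‖ + ‖ℓ‖) / κ) ^ 2 := by
      simp only [M]
      field_simp
      ring
    rw [h5]
    nlinarith [mul_nonneg (half_pos hκ).le (sq_nonneg (‖x‖ - (‖w‖ * ‖L‖ + ‖ℓ‖) / κ))]
  have hEmem : MemLp E 2 volume :=
    (SchwartzMap.memLp _ 2).of_le_mul hEc.aestronglyMeasurable (ae_of_all _ hEle)
  have hbound : ∀ x, HasSum (fun n : ℕ =>
      ‖f x‖ * (‖w * (L x + ρ)‖ ^ n / n.factorial * Real.exp (q x).re)) (‖f x‖ * E x) := fun x => by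
    have h := NormedSpace.expSeries_div_hasSum_exp (‖w * (L x + ρ)‖)
    rw [← Real.exp_eq_exp_ℝ] at h
    have h' := (h.mul_right (Real.exp (q x).re)).mul_left ‖f x‖
    rwa [← Real.exp_add] at h'
  have hnorm : ∀ (n : ℕ) (x : V),
      ‖conj w ^ n / n.factorial * (f x * conj (polyGauss κ L ρ ℓ n x))‖ =
      ‖f x‖ * (‖w * (L x + ρ)‖ ^ n / n.factorial * Real.exp (q x).re) := fun n x => by
    rw [polyGauss]
    simp only [norm_mul, norm_div, norm_pow, RCLike.norm_conj, Complex.norm_exp,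
      Complex.norm_natCast, mul_pow, hq]
    ring
  have hcontP : ∀ n, Continuous (polyGauss κ L ρ ℓ n) := fun n => by
    unfold polyGauss
    fun_prop
  have key := hasSum_integral_of_dominated_convergence (μ := (volume : Measure V))
    (F := fun (n : ℕ) x => conj w ^ n / n.factorial * (f x * conj (polyGauss κ L ρ ℓ n x)))
    (f := fun x => f x * conj (Complex.exp (w * (L x + ρ) + q x)))
    (fun n x => ‖f x‖ * (‖w * (L x + ρ)‖ ^ n / n.factorial * Real.exp (q x).re))
    (fun n => ((Lp.aestronglyMeasurable f).mul
      (Complex.continuous_conj.comp (hcontP n)).aestronglyMeasurable).const_mul _)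
    (fun n => ae_of_all _ fun x => (hnorm n x).le)
    (ae_of_all _ fun x => (hbound x).summable)
    (by
      simp_rw [fun x => (hbound x).tsum_eq]
      exact (Lp.memLp f).norm.integrable_mul hEmem)
    (ae_of_all _ fun x => by
      have h := NormedSpace.expSeries_div_hasSum_exp (conj w * conj (L x + ρ))
      rw [← Complex.exp_eq_exp_ℂ] at h
      have h' := (h.mul_right (conj (Complex.exp (q x)))).mul_left (f x)
      rw [Complex.exp_add, map_mul, ← Complex.exp_conj (w * (L x + ρ)), map_mul]
      refine h'.congr_fun fun n => ?_
      simp only [polyGauss, map_mul, map_pow, mul_pow, hq]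
      ring)
  simpa only [integral_const_mul] using key

/-- Evolution of the pairings of a solution with Gaussians (coherent states): up to a phase, pairing
`u t` with such a Gaussian is pairing `u₀` with the one in which `b·z + ρ` is multiplied by
`exp (8iκt)`. This is the sum of `pairing_eigenfunction` over the eigenvalues `4κ(2n + d)`, with
weights `1 / n!`. -/
lemma IsSchrodingerSolution.pairing_gaussian {d : ℕ} {κ ε : ℝ} (hκ : 0 < κ) (hε : ε ^ 2 = 1)
    {u₀ : Lp ℂ 2 (volume : Measure (Cd d))} {u : ℝ → Lp ℂ 2 (volume : Measure (Cd d))}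
    (hu : IsSchrodingerSolution (4 * κ * ε) u₀ u) {t : ℝ} (ht : 0 < t) (b c : Fin d → ℂ) :
    ∫ z, (u t) z * conj (Complex.exp (
        1 * (realLin b (fun j => Complex.I * ε * b j) z + -(∑ j, b j * c j) / (2 * κ)) +
        (-(κ : ℂ) * (‖z‖ : ℂ) ^ 2 + realLin c (fun j => -(Complex.I * ε * c j)) z))) =
      Complex.exp (-(Complex.I * (4 * κ * d) * t)) *
      ∫ z, u₀ z * conj (Complex.exp (Complex.exp (2 * (4 * κ * t) * Complex.I) *
        (realLin b (fun j => Complex.I * ε * b j) z + -(∑ j, b j * c j) / (2 * κ)) +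
        (-(κ : ℂ) * (‖z‖ : ℂ) ^ 2 + realLin c (fun j => -(Complex.I * ε * c j)) z))) := by
  set L := realLin b (fun j => Complex.I * ε * b j) with hL
  set ℓ := realLin c (fun j => -(Complex.I * ε * c j)) with hℓ
  set ρ : ℂ := -(∑ j, b j * c j) / (2 * κ) with hρ
  have h1 := hasSum_pairing_polyGauss hκ L ρ ℓ 1 (u t)
  have h2 := (hasSum_pairing_polyGauss hκ L ρ ℓ (Complex.exp (2 * (4 * κ * t) * Complex.I))
    u₀).mul_left (Complex.exp (-(Complex.I * (4 * κ * d) * t)))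
  refine h1.unique (h2.congr_fun fun n => ?_)
  have h3 := hu.pairing_eigenfunction (polyGaussSchwartz hκ L ρ ℓ n)
    (μ := 4 * κ * (2 * n + d)) (fun z => by
      rw [coe_polyGaussSchwartz]
      exact specialHermite_polyGauss hκ.ne' hε b c n z) ht
  rw [coe_polyGaussSchwartz] at h3
  rw [h3, ← Complex.exp_conj, ← Complex.exp_nat_mul, map_one, one_pow]
  have h4 : Complex.exp (-(Complex.I * ((4 * κ * (2 * n + d) : ℝ) : ℂ) * t)) =
      Complex.exp (-(Complex.I * (4 * κ * d) * t)) *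
        Complex.exp (n * conj (2 * (4 * κ * t) * Complex.I)) := by
    rw [← Complex.exp_add]
    congr 1
    simp only [map_mul, Complex.conj_ofReal, Complex.conj_I, map_ofNat]
    push_cast
    ring
  rw [h4]
  ring

end Pairing

/-! ### The solution as a Fourier transform -/

section Representation

variable {d : ℕ}

/-- The real orthonormal basis of `ℂ^d` consisting of the vectors `eⱼ` and `i eⱼ`. -/
noncomputable def realBasisCd (d : ℕ) : OrthonormalBasis ((_ : Fin d) × Fin 2) ℝ (Cd d) :=
  Pi.orthonormalBasis fun _ => Complex.orthonormalBasisOneI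

lemma realBasisCd_zero (j : Fin d) : realBasisCd d ⟨j, 0⟩ = EuclideanSpace.single j (1 : ℂ) := by
  rw [realBasisCd, Pi.orthonormalBasis_apply]
  simp

lemma realBasisCd_one (j : Fin d) :
    realBasisCd d ⟨j, 1⟩ = EuclideanSpace.single j Complex.I := by
  rw [realBasisCd, Pi.orthonormalBasis_apply]
  simp

lemma fourier_gaussian_realLin {a : ℂ} (ha : 0 < a.re) (α β : Fin d → ℂ) (ξ : Cd d) :
    𝓕 (fun z : Cd d => Complex.exp (-a * (‖z‖ : ℂ) ^ 2 + realLin α β z)) ξ =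
      (Real.pi / a) ^ ((Fintype.card ((_ : Fin d) × Fin 2) : ℂ) / 2) *
        Complex.exp (∑ j, ((α j - 2 * Real.pi * Complex.I * (ξ j).re) ^ 2 +
          (β j - 2 * Real.pi * Complex.I * (ξ j).im) ^ 2) / (4 * a)) := by
  have h := integral_cexp_neg_mul_sq_norm_add_clm (realBasisCd d) ha
    (realLin (fun j => α j - 2 * Real.pi * Complex.I * (ξ j).re)
      (fun j => β j - 2 * Real.pi * Complex.I * (ξ j).im))
  rw [Fintype.sum_sigma] at h
  simp only [Fin.sum_univ_two, realBasisCd_zero, realBasisCd_one, realLin_single_one,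
    realLin_single_I] at h
  rw [← Finset.sum_div, ← h, Real.fourier_eq']
  congr 1; ext z
  rw [smul_eq_mul, ← Complex.exp_add]
  congr 1
  have h1 : ((-2 * Real.pi * (inner ℝ z ξ : ℝ) : ℝ) : ℂ) * Complex.I =
      ∑ j, -(2 * Real.pi * Complex.I * ((z j).re * (ξ j).re + (z j).im * (ξ j).im)) := by
    rw [real_inner_eq_sum, Finset.sum_neg_distrib, ← Finset.mul_sum]
    push_cast
    ring
  have h2 : realLin (fun j => α j - 2 * Real.pi * Complex.I * (ξ j).re)
      (fun j => β j - 2 * Real.pi * Complex.I * (ξ j).im) z =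
      realLin α β z +
        ∑ j, -(2 * Real.pi * Complex.I * ((z j).re * (ξ j).re + (z j).im * (ξ j).im)) := by
    rw [realLin_apply, realLin_apply, ← Finset.sum_add_distrib]
    refine Finset.sum_congr rfl fun j _ => ?_
    ring
  rw [h1, h2]
  ring

/-- One coordinate of the exponent in the Fourier transform of an evolved coherent state, expanded in
`x + iεy` and `x - iεy`; here `C`, `S` are the cosine and sine, and `w` is arbitrary. -/
lemma sq_add_sq_phase {b c x y κ ε C S i w : ℂ} (hS : S ≠ 0) (hi : i ^ 2 = -1)
    (hε : ε ^ 2 = 1) (hCS : C ^ 2 + S ^ 2 = 1) :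
    (w * b + c - 2 * i * κ / S * (C * x + ε * S * y)) ^ 2 +
        (i * ε * (w * b - c) - 2 * i * κ / S * (C * y - ε * S * x)) ^ 2 =
      4 * w * b * c - 4 * i * κ / S * (w * b * (C - S * i) * (x + i * ε * y) +
        c * (C + S * i) * (x - i * ε * y)) - 4 * κ ^ 2 / S ^ 2 * (x ^ 2 + y ^ 2) := by
  field_simp
  grind

/-- One coordinate of the exponent identity behind `fourier_coherentState`: with `w = (C + Si)²`,
`Z = x + iεy`, `Zb = x - iεy` and `r = x² + y²`, the evolved exponent is the original one up to the
quadratic phase `-iκ(C/S)r`. -/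
lemma gaussian_phase {b c Z Zb r κ C S i : ℂ} (hκ : κ ≠ 0) (hS : S ≠ 0) (hi : i ^ 2 = -1)
    (hCS : C ^ 2 + S ^ 2 = 1) :
    (C + S * i) ^ 2 * (-(b * c) / (2 * κ)) +
        (4 * (C + S * i) ^ 2 * b * c - 4 * i * κ / S * ((C + S * i) ^ 2 * b * (C - S * i) * Z +
          c * (C + S * i) * Zb) - 4 * κ ^ 2 / S ^ 2 * r) * (i * S * (C - S * i) / (4 * κ)) =
      b * Z + c * Zb - b * c / (2 * κ) - κ * r - i * κ * (C / S) * r := by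
  field_simp
  grind

lemma re_sub_I_mul_mul (κ r : ℝ) (C S : ℝ) (h : r = C / S) :
    ((κ : ℂ) - Complex.I * κ * ((C : ℂ) / (S : ℂ))).re = κ := by
  rw [← Complex.ofReal_div, ← h]
  simp

lemma re_mul_sub_mul_I_mul (r p q : ℝ) (z : ℂ) :
    (((r : ℂ) * ((p : ℂ) - (q : ℂ) * Complex.I)) * z).re = r * (p * z.re + q * z.im) := by
  simp
  ring

lemma im_mul_sub_mul_I_mul (r p q : ℝ) (z : ℂ) :
    (((r : ℂ) * ((p : ℂ) - (q : ℂ) * Complex.I)) * z).im = r * (p * z.im - q * z.re) := by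
  simp
  ring

/-- The Fourier transform of an evolved coherent state, multiplied by a quadratic phase, is at the
rotated and dilated point the original coherent state times the conjugate phase. The parameters are
`θ` with `sin θ ≠ 0` and `a = κ (1 - i cot θ)`. -/
lemma fourier_coherentState {κ ε θ : ℝ} (hκ : 0 < κ) (hε : ε ^ 2 = 1) (hθ : Real.sin θ ≠ 0)
    {a : ℂ} (ha : a = κ - Complex.I * κ * (Real.cos θ / Real.sin θ)) (b c : Fin d → ℂ)
    (z ζ : Cd d)
    (hre : ∀ j, (ζ j).re =
      κ / (Real.pi * Real.sin θ) * (Real.cos θ * (z j).re + ε * Real.sin θ * (z j).im))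
    (him : ∀ j, (ζ j).im =
      κ / (Real.pi * Real.sin θ) * (Real.cos θ * (z j).im - ε * Real.sin θ * (z j).re)) :
    Complex.exp (Complex.exp (2 * θ * Complex.I) * (-(∑ j, b j * c j) / (2 * κ))) *
      𝓕 (fun z : Cd d => Complex.exp (-a * (‖z‖ : ℂ) ^ 2 +
        realLin (fun j => Complex.exp (2 * θ * Complex.I) * b j + c j)
          (fun j => Complex.I * ε * (Complex.exp (2 * θ * Complex.I) * b j - c j)) z)) ζ =
      (Real.pi / a) ^ ((Fintype.card ((_ : Fin d) × Fin 2) : ℂ) / 2) *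
        (Complex.exp (-(Complex.I * κ * (Real.cos θ / Real.sin θ) * (‖z‖ : ℂ) ^ 2)) *
        Complex.exp (1 * (realLin b (fun j => Complex.I * ε * b j) z +
            -(∑ j, b j * c j) / (2 * κ)) +
          (-(κ : ℂ) * (‖z‖ : ℂ) ^ 2 + realLin c (fun j => -(Complex.I * ε * c j)) z))) := by
  have hare : a.re = κ := by rw [ha, re_sub_I_mul_mul κ _ _ _ rfl]
  have hκC : (κ : ℂ) ≠ 0 := by exact_mod_cast hκ.ne'
  have hS : ((Real.sin θ : ℝ) : ℂ) ≠ 0 := by exact_mod_cast hθ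
  have hεC : (ε : ℂ) ^ 2 = 1 := by exact_mod_cast hε
  have hπ : (Real.pi : ℂ) ≠ 0 := by exact_mod_cast Real.pi_ne_zero
  have hCS : ((Real.cos θ : ℝ) : ℂ) ^ 2 + ((Real.sin θ : ℝ) : ℂ) ^ 2 = 1 := by
    exact_mod_cast Real.cos_sq_add_sin_sq θ
  have hI := Complex.I_sq
  have hw : Complex.exp (2 * θ * Complex.I) =
      (((Real.cos θ : ℝ) : ℂ) + ((Real.sin θ : ℝ) : ℂ) * Complex.I) ^ 2 := by
    rw [Complex.ofReal_cos, Complex.ofReal_sin, ← Complex.exp_mul_I, ← Complex.exp_nat_mul]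
    congr 1
    push_cast
    ring
  rw [fourier_gaussian_realLin (hare ▸ hκ), mul_left_comm, ← Complex.exp_add, ← Complex.exp_add]
  congr 2
  have ha0 : a ≠ 0 := by
    intro h
    rw [h, Complex.zero_re] at hare
    exact hκ.ne hare
  have hinv : 1 / (4 * a) = Complex.I * (Real.sin θ : ℝ) *
      (((Real.cos θ : ℝ) : ℂ) - ((Real.sin θ : ℝ) : ℂ) * Complex.I) / (4 * κ) := by
    rw [div_eq_div_iff (by simpa using ha0) (by simpa using hκC), ha]
    field_simp
    grind
  rw [hw, realLin_apply, realLin_apply, norm_sq_Cd_cast]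
  simp only [one_mul, Finset.mul_sum, neg_mul, ← Finset.sum_neg_distrib, Finset.sum_div,
    ← Finset.sum_add_distrib]
  refine Finset.sum_congr rfl fun j _ => ?_
  have h1 : 2 * (Real.pi : ℂ) * Complex.I * (ζ j).re = 2 * Complex.I * κ / (Real.sin θ : ℝ) *
      ((Real.cos θ : ℝ) * (z j).re + ε * (Real.sin θ : ℝ) * (z j).im) := by
    rw [hre]; push_cast; field_simp
  have h2 : 2 * (Real.pi : ℂ) * Complex.I * (ζ j).im = 2 * Complex.I * κ / (Real.sin θ : ℝ) *
      ((Real.cos θ : ℝ) * (z j).im - ε * (Real.sin θ : ℝ) * (z j).re) := by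
    rw [him]; push_cast; field_simp
  rw [h1, h2, sq_add_sq_phase hS hI hεC hCS, div_eq_mul_one_div _ (4 * a), hinv,
    gaussian_phase hκC hS hI hCS]
  ring

lemma exists_map_smul_volume {τ : ℂ} (hτ : τ ≠ 0) :
    ∃ c : ℝ≥0∞, c ≠ 0 ∧ c ≠ ∞ ∧
      Measure.map (fun z : Cd d => τ • z) volume = c • (volume : Measure (Cd d)) := by
  set T : Cd d ≃ₗ[ℝ] Cd d := (LinearEquiv.smulOfNeZero ℂ (Cd d) τ hτ).restrictScalars ℝ
  have hdet : LinearMap.det (T : Cd d →ₗ[ℝ] Cd d) ≠ 0 := T.isUnit_det'.ne_zero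
  refine ⟨ENNReal.ofReal |(LinearMap.det (T : Cd d →ₗ[ℝ] Cd d))⁻¹|, ?_, ENNReal.ofReal_ne_top,
    Measure.map_linearMap_addHaar_eq_smul_addHaar volume hdet⟩
  rw [Ne, ENNReal.ofReal_eq_zero, not_le]
  exact abs_pos.2 (inv_ne_zero hdet)

lemma measurableEmbedding_smul {τ : ℂ} (hτ : τ ≠ 0) :
    MeasurableEmbedding (fun z : Cd d => τ • z) :=
  (Homeomorph.smulOfNeZero τ hτ).measurableEmbedding

/-- Up to a unimodular quadratic phase, a nonzero constant factor and a complex dilation, the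
solution at time `t` is the Fourier transform of the initial datum multiplied by a unimodular
function. -/
theorem IsSchrodingerSolution.exists_fourier_representation {κ ε : ℝ} (hκ : 0 < κ)
    (hε : ε ^ 2 = 1) {t : ℝ} (ht : 0 < t) (hsin : Real.sin (4 * κ * t) ≠ 0) :
    ∃ (K τ : ℂ), K ≠ 0 ∧ τ ≠ 0 ∧
      ∀ (u₀ : Lp ℂ 2 (volume : Measure (Cd d))) (u : ℝ → Lp ℂ 2 (volume : Measure (Cd d))),
        IsSchrodingerSolution (4 * κ * ε) u₀ u →
        ∃ f : Lp ℂ 2 (volume : Measure (Cd d)), (∀ᵐ z, ‖f z‖ = ‖u₀ z‖) ∧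
          ∀ᵐ z, ‖(u t) z‖ = ‖K‖ * ‖(𝓕 f : Lp ℂ 2 (volume : Measure (Cd d))) (τ • z)‖ := by
  set θ : ℝ := 4 * κ * t with hθdef
  set a : ℂ := κ - Complex.I * κ * (Real.cos θ / Real.sin θ) with ha
  have hare : 0 < a.re := by rwa [ha, re_sub_I_mul_mul κ _ _ _ rfl]
  have ha0 : a ≠ 0 := by
    intro h
    rw [h, Complex.zero_re] at hare
    exact lt_irrefl _ hare
  set χ : Cd d → ℂ := fun z => Complex.exp (Complex.I * κ * (Real.cos θ / Real.sin θ) *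
    (‖z‖ : ℂ) ^ 2) with hχ
  have hχc : Continuous χ := by fun_prop
  have hχform : ∀ z, χ z =
      Complex.exp (((κ * (Real.cos θ / Real.sin θ) * ‖z‖ ^ 2 : ℝ) : ℂ) * Complex.I) := fun z => by
    simp only [hχ]; congr 1; push_cast; ring
  have hχ1 : ∀ z, ‖χ z‖ = 1 := fun z => by rw [hχform, Complex.norm_exp_ofReal_mul_I]
  have hχconj : ∀ z, conj (Complex.exp (-(Complex.I * κ * (Real.cos θ / Real.sin θ) *
      (‖z‖ : ℂ) ^ 2))) = χ z := fun z => by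
    rw [← Complex.exp_conj, hχform]
    congr 1
    simp only [map_neg, map_mul, map_pow, map_div₀, Complex.conj_I, Complex.conj_ofReal]
    push_cast
    ring
  have hχχ : ∀ z, χ z * conj (χ z) = 1 := fun z => by
    rw [Complex.mul_conj, Complex.normSq_eq_norm_sq, hχ1]; simp
  set τ : ℂ := ((κ / (Real.pi * Real.sin θ) : ℝ) : ℂ) *
    (((Real.cos θ : ℝ) : ℂ) - ((ε * Real.sin θ : ℝ) : ℂ) * Complex.I) with hτdef
  have hτ : τ ≠ 0 := by
    refine mul_ne_zero ?_ fun h => ?_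
    · exact_mod_cast div_ne_zero hκ.ne' (mul_ne_zero Real.pi_ne_zero hsin)
    · have h2 := congrArg Complex.im h
      simp at h2
      rcases h2 with h2 | h2
      · rw [h2] at hε; norm_num at hε
      · exact hsin h2
  obtain ⟨m, hm0, hmtop, hmap⟩ := exists_map_smul_volume (d := d) hτ
  have hmpos : 0 < m.toReal := ENNReal.toReal_pos hm0 hmtop
  set Kf : ℂ := (Real.pi / a) ^ ((Fintype.card ((_ : Fin d) × Fin 2) : ℂ) / 2) with hKf
  have hKf0 : Kf ≠ 0 := by
    rw [hKf, Ne, Complex.cpow_eq_zero_iff]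
    exact fun h => div_ne_zero (by exact_mod_cast Real.pi_ne_zero) ha0 h.1
  set ph : ℂ := Complex.exp (-(Complex.I * (4 * κ * d) * t)) with hph
  set K : ℂ := ph * ((m.toReal)⁻¹ : ℝ) * conj Kf with hK
  have hK0 : K ≠ 0 :=
    mul_ne_zero (mul_ne_zero (Complex.exp_ne_zero _)
      (by exact_mod_cast inv_ne_zero hmpos.ne')) ((map_ne_zero _).2 hKf0)
  refine ⟨K, τ, hK0, hτ, fun u₀ u hu => ?_⟩
  have hfmem : MemLp (fun z => χ z * u₀ z) 2 volume :=
    (Lp.memLp u₀).of_le (hχc.aestronglyMeasurable.mul (Lp.aestronglyMeasurable u₀))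
      (ae_of_all _ fun z => by rw [norm_mul, hχ1, one_mul])
  set f : Lp ℂ 2 (volume : Measure (Cd d)) := hfmem.toLp _ with hf
  refine ⟨f, ?_, ?_⟩
  · filter_upwards [hfmem.coeFn_toLp] with z hz
    rw [hf, hz, norm_mul, hχ1, one_mul]
  set Ff : Lp ℂ 2 (volume : Measure (Cd d)) := 𝓕 f with hFf
  have hFfT : MemLp (fun z => Ff (τ • z)) 2 volume := by
    have h1 : MemLp (Ff : Cd d → ℂ) 2 (Measure.map (fun z : Cd d => τ • z) volume) := by
      rw [hmap]
      exact (Lp.memLp Ff).smul_measure hmtop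
    exact h1.comp_of_map (measurableEmbedding_smul hτ).measurable.aemeasurable
  have hvmem : MemLp (fun z => K * (χ z * Ff (τ • z))) 2 volume :=
    (hFfT.of_le (hχc.aestronglyMeasurable.mul hFfT.aestronglyMeasurable)
      (ae_of_all _ fun z => by rw [Pi.mul_apply, norm_mul, hχ1, one_mul])).const_mul K
  have hchange : ∀ F : Cd d → ℂ, ∫ ξ, F ξ = ((m.toReal)⁻¹ : ℝ) * ∫ z, F (τ • z) := fun F => by
    rw [← (measurableEmbedding_smul hτ).integral_map, hmap, integral_smul_measure,
      Complex.real_smul, ← mul_assoc, ← Complex.ofReal_mul, inv_mul_cancel₀ hmpos.ne',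
      Complex.ofReal_one, one_mul]
  -- it suffices to compare the pairings with Gaussian multiples of characters
  have hzero : u t - hvmem.toLp _ = 0 := by
    refine eq_zero_of_integral_mul_gaussian_char hκ _ fun ξ => ?_
    set b : Fin d → ℂ := fun j => (2 * Real.pi * Complex.I * (ξ j).re -
      Complex.I * ε * (2 * Real.pi * Complex.I * (ξ j).im)) / 2 with hb
    set c : Fin d → ℂ := fun j => (2 * Real.pi * Complex.I * (ξ j).re +
      Complex.I * ε * (2 * Real.pi * Complex.I * (ξ j).im)) / 2 with hc
    have hεC : (ε : ℂ) ^ 2 = 1 := by exact_mod_cast hε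
    set ρ : ℂ := -(∑ j, b j * c j) / (2 * κ) with hρ
    set w : ℂ := Complex.exp (2 * θ * Complex.I) with hw
    set L := realLin b (fun j => Complex.I * ε * b j) with hL
    set ℓ := realLin c (fun j => -(Complex.I * ε * c j)) with hℓ
    have hchar : ∀ z, L z + ℓ z = 2 * Real.pi * Complex.I * (inner ℝ z ξ : ℝ) := fun z => by
      rw [hL, hℓ, realLin_apply, realLin_apply, real_inner_eq_sum, ← Finset.sum_add_distrib,
        Complex.ofReal_sum, Finset.mul_sum]
      refine Finset.sum_congr rfl fun j _ => ?_
      simp only [hb, hc]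
      push_cast
      linear_combination (-2 * Real.pi * Complex.I * (z j).im * (ξ j).im * ε ^ 2) *
        Complex.I_sq + (2 * Real.pi * Complex.I * (z j).im * (ξ j).im) * hεC
    set g : 𝓢(Cd d, ℂ) := gaussianSchwartz (a := (κ : ℂ)) (by simpa using hκ) (L + ℓ) with hg
    have hgχ : ∀ z, Complex.exp (1 * (L z + ρ) + (-(κ : ℂ) * (‖z‖ : ℂ) ^ 2 + ℓ z)) =
        Complex.exp ρ * g z := fun z => by
      rw [hg, gaussianSchwartz_apply, ← Complex.exp_add, add_apply]
      congr 1; ring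
    have hρ0 : conj (Complex.exp ρ) ≠ 0 := (map_ne_zero _).2 (Complex.exp_ne_zero _)
    have hpair := hu.pairing_gaussian hκ hε ht b c
    rw [← hL, ← hℓ, ← hρ] at hpair
    have hw' : Complex.exp (2 * (4 * κ * t) * Complex.I) = w := by
      rw [hw, hθdef]; push_cast; rfl
    rw [hw', ← hph] at hpair
    -- Plancherel for the evolved coherent state
    set Φ : 𝓢(Cd d, ℂ) := gaussianSchwartz hare
      (realLin (fun j => w * b j + c j) (fun j => Complex.I * ε * (w * b j - c j))) with hΦ
    have hΦχ : ∀ z, χ z * Complex.exp (w * (L z + ρ) +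
        (-(κ : ℂ) * (‖z‖ : ℂ) ^ 2 + ℓ z)) = Complex.exp (w * ρ) * Φ z := fun z => by
      rw [hΦ, gaussianSchwartz_apply]
      simp only [hχ]
      rw [← Complex.exp_add, ← Complex.exp_add]
      congr 1
      have : realLin (fun j => w * b j + c j)
          (fun j => Complex.I * ε * (w * b j - c j)) z = w * L z + ℓ z := by
        rw [hL, hℓ, realLin_apply, realLin_apply, realLin_apply, Finset.mul_sum,
          ← Finset.sum_add_distrib]
        refine Finset.sum_congr rfl fun j _ => ?_
        ring
      rw [this, ha]
      ring
    have e1 : ∫ z, u₀ z * conj (Complex.exp (w * (L z + ρ) +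
        (-(κ : ℂ) * (‖z‖ : ℂ) ^ 2 + ℓ z))) =
        conj (Complex.exp (w * ρ)) * ∫ ξ, Ff ξ * conj (𝓕 (Φ : Cd d → ℂ) ξ) := by
      have h1 : ∫ z, u₀ z * conj (Complex.exp (w * (L z + ρ) +
          (-(κ : ℂ) * (‖z‖ : ℂ) ^ 2 + ℓ z))) =
          conj (Complex.exp (w * ρ)) * ∫ z, f z * conj (Φ z) := by
        rw [← integral_const_mul]
        refine integral_congr_ae ?_
        filter_upwards [hfmem.coeFn_toLp] with z hz
        rw [hf, hz]
        have h2 := congrArg conj (hΦχ z)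
        rw [map_mul, map_mul] at h2
        linear_combination (χ z * u₀ z) * h2 -
          u₀ z * conj (Complex.exp (w * (L z + ρ) +
            (-(κ : ℂ) * (‖z‖ : ℂ) ^ 2 + ℓ z))) * hχχ z
      have h2 : ∫ ξ, Ff ξ * conj (𝓕 (Φ : Cd d → ℂ) ξ) =
          inner ℂ ((𝓕 Φ).toLp 2) Ff := by
        rw [← SchwartzMap.fourier_coe]
        exact integral_mul_conj_eq_inner Ff ((𝓕 Φ).memLp 2)
      rw [h1, h2, ← SchwartzMap.toLp_fourier_eq, hFf, Lp.inner_fourier_eq,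
        integral_mul_conj_eq_inner f (Φ.memLp 2)]
      rfl
    have e2 : ∀ z, conj (Complex.exp (w * ρ)) * (Ff (τ • z) * conj (𝓕 (Φ : Cd d → ℂ) (τ • z))) =
        Ff (τ • z) * (conj Kf * (χ z * conj (Complex.exp ρ * g z))) := fun z => by
      have h1 := fourier_coherentState (z := z) (ζ := τ • z) hκ hε hsin ha b c
        (fun j => by rw [PiLp.smul_apply, smul_eq_mul, hτdef, re_mul_sub_mul_I_mul])
        (fun j => by rw [PiLp.smul_apply, smul_eq_mul, hτdef, im_mul_sub_mul_I_mul])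
      rw [← hL, ← hℓ, ← hρ, ← hKf, hgχ] at h1
      have h2 := congrArg conj h1
      rw [map_mul, map_mul, map_mul, hχconj] at h2
      have h3 : 𝓕 (Φ : Cd d → ℂ) (τ • z) = 𝓕 (fun z : Cd d => Complex.exp (-a * (‖z‖ : ℂ) ^ 2 +
        realLin (fun j => Complex.exp (2 * θ * Complex.I) * b j + c j)
          (fun j => Complex.I * ε * (Complex.exp (2 * θ * Complex.I) * b j - c j)) z))
          (τ • z) := rfl
      rw [h3]
      linear_combination Ff (τ • z) * h2
    have e3 : ∫ z, (u t) z * conj (Complex.exp ρ * g z) =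
        ∫ z, (hvmem.toLp _ : Lp ℂ 2 (volume : Measure (Cd d))) z *
          conj (Complex.exp ρ * g z) := by
      have h1 : ∫ z, (u t) z * conj (Complex.exp ρ * g z) = ph *
          ∫ z, u₀ z * conj (Complex.exp (w * (L z + ρ) +
            (-(κ : ℂ) * (‖z‖ : ℂ) ^ 2 + ℓ z))) := by
        rw [← hpair]
        simp_rw [hgχ]
      rw [h1, e1, hchange, mul_left_comm (conj (Complex.exp (w * ρ))), ← integral_const_mul,
        ← mul_assoc, ← integral_const_mul]
      refine integral_congr_ae ?_
      filter_upwards [hvmem.coeFn_toLp] with z hz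
      rw [hz, e2 z, hK]
      ring
    have e4 : ∀ F : Lp ℂ 2 (volume : Measure (Cd d)),
        ∫ z, F z * conj (Complex.exp ρ * g z) =
          conj (Complex.exp ρ) * inner ℂ ((g.memLp 2).toLp g) F := fun F => by
      rw [← integral_mul_conj_eq_inner, ← integral_const_mul]
      congr 1; ext z
      rw [map_mul]; ring
    rw [e4, e4] at e3
    have e5 := mul_left_cancel₀ hρ0 e3
    have e6 : ∀ z, Complex.exp (-(κ : ℂ) * (‖z‖ : ℂ) ^ 2 +
        2 * Real.pi * Complex.I * (inner ℝ z ξ : ℝ)) = g z := fun z => by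
      rw [hg, gaussianSchwartz_apply, add_apply, hchar]
    simp_rw [e6]
    rw [integral_mul_conj_eq_inner _ (g.memLp 2), inner_sub_right, e5, sub_self]
  rw [sub_eq_zero] at hzero
  rw [hzero]
  filter_upwards [hvmem.coeFn_toLp] with z hz
  rw [hz, norm_mul K, norm_mul (χ z), hχ1, one_mul]

end Representation

/-! ### The uncertainty inequality for solutions -/

theorem theorem1p2 (d : ℕ) (hd : 1 ≤ d) (lam : ℝ) (hlam : lam ≠ 0) (t : ℝ) (ht : 0 < t)
    (hlt : ∀ k : ℤ, lam * t ≠ k * Real.pi)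
    (E Ω : Set (Cd d)) (hE : NullMeasurableSet E volume) (hΩ : NullMeasurableSet Ω volume)
    (hEfin : volume E < ∞) (hΩfin : volume Ω < ∞) :
    ∃ C : ℝ, 0 < C ∧
      ∀ (u₀ : Lp ℂ 2 (volume : Measure (Cd d))) (u : ℝ → Lp ℂ 2 (volume : Measure (Cd d))),
        IsSchrodingerSolution lam u₀ u →
          ∫ z, ‖u₀ z‖ ^ 2 ≤
            C * ((∫ z in Eᶜ, ‖u₀ z‖ ^ 2) + ∫ z in Ωᶜ, ‖(u t) z‖ ^ 2) := by
  have : Nonempty (Fin d) := ⟨⟨0, hd⟩⟩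
  have : Nontrivial (Cd d) := (WithLp.equiv 2 (Fin d → ℂ)).nontrivial
  obtain ⟨κ, ε, hκ, hε, hlamκ⟩ : ∃ κ ε : ℝ, 0 < κ ∧ ε ^ 2 = 1 ∧ lam = 4 * κ * ε := by
    rcases hlam.lt_or_gt with h | h
    · exact ⟨-lam / 4, -1, by linarith, by norm_num, by ring⟩
    · exact ⟨lam / 4, 1, by linarith, by norm_num, by ring⟩
  have hsin : Real.sin (4 * κ * t) ≠ 0 := fun h => by
    obtain ⟨n, hn⟩ := Real.sin_eq_zero_iff.1 h
    rcases sq_eq_sq_iff_eq_or_eq_neg.1 (hε.trans (one_pow 2).symm) with rfl | rfl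
    · exact hlt n (by rw [hlamκ, hn]; ring)
    · exact hlt (-n) (by rw [hlamκ]; push_cast; rw [neg_mul, hn]; ring)
  obtain ⟨K, τ, hK, hτ, hrep⟩ :=
    IsSchrodingerSolution.exists_fourier_representation (d := d) hκ hε ht hsin
  obtain ⟨c, hc0, hctop, hmap⟩ := exists_map_smul_volume (d := d) hτ
  have hemb := measurableEmbedding_smul (d := d) hτ
  -- measurable hulls make the complements smaller, which only strengthens the inequality
  set E' := toMeasurable volume E
  set Ω' := toMeasurable volume Ω
  have hE' : MeasurableSet E' := measurableSet_toMeasurable _ _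
  have hΩ' : MeasurableSet Ω' := measurableSet_toMeasurable _ _
  set F : Set (Cd d) := (fun z => τ • z) '' Ω' with hFdef
  have hF : MeasurableSet F := hemb.measurableSet_image.2 hΩ'
  have hpre : (fun z : Cd d => τ • z) ⁻¹' F = Ω' := preimage_image_eq _ hemb.injective
  have hFfin : volume F ≠ ∞ := fun h => by
    have h1 := congrArg (fun μ : Measure (Cd d) => μ F) hmap
    simp only [hemb.map_apply, hpre, Measure.smul_apply, smul_eq_mul, h,
      ENNReal.mul_top hc0] at h1
    exact hΩfin.ne (by rw [← measure_toMeasurable]; exact h1)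
  obtain ⟨C, hC, hAB⟩ := amrein_berthier hE'
    (by rw [measure_toMeasurable]; exact hEfin.ne) hF hFfin
  have hcpos : 0 < c.toReal := ENNReal.toReal_pos hc0 hctop
  have hKpos : 0 < ‖K‖ := norm_pos_iff.2 hK
  set M : ℝ := c.toReal * ‖K‖ ^ 2
  have hM : 0 < M := by positivity
  refine ⟨C * (1 + M⁻¹), by positivity, fun u₀ u hu => ?_⟩
  rw [hlamκ] at hu
  obtain ⟨f, hf, hft⟩ := hrep u₀ u hu
  have hAf := hAB f
  set B : ℝ := ∫ ξ in Fᶜ, ‖(𝓕 f : Lp ℂ 2 (volume : Measure (Cd d))) ξ‖ ^ 2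
  have e0 : ‖f‖ ^ 2 = ∫ z, ‖u₀ z‖ ^ 2 := by
    rw [Lp_norm_sq_eq_integral]
    refine integral_congr_ae ?_
    filter_upwards [hf] with z hz
    rw [hz]
  have e1 : ∫ z in E'ᶜ, ‖f z‖ ^ 2 = ∫ z in E'ᶜ, ‖u₀ z‖ ^ 2 := by
    refine integral_congr_ae (ae_restrict_of_ae ?_)
    filter_upwards [hf] with z hz
    rw [hz]
  have e2 : ∫ z in Ω'ᶜ, ‖(u t) z‖ ^ 2 = M * B := by
    have h1 : ∫ z in Ω'ᶜ, ‖(u t) z‖ ^ 2 =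
        ∫ z in Ω'ᶜ, ‖K‖ ^ 2 * ‖(𝓕 f : Lp ℂ 2 (volume : Measure (Cd d))) (τ • z)‖ ^ 2 := by
      refine integral_congr_ae (ae_restrict_of_ae ?_)
      filter_upwards [hft] with z hz
      rw [hz, mul_pow]
    have h2 := hemb.setIntegral_map (μ := volume)
      (fun ξ => ‖(𝓕 f : Lp ℂ 2 (volume : Measure (Cd d))) ξ‖ ^ 2) Fᶜ
    rw [hmap, Measure.restrict_smul, integral_smul_measure, preimage_compl, hpre,
      smul_eq_mul] at h2
    rw [h1, integral_const_mul, ← h2]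
    ring
  have i1 : ∫ z in E'ᶜ, ‖u₀ z‖ ^ 2 ≤ ∫ z in Eᶜ, ‖u₀ z‖ ^ 2 :=
    setIntegral_mono_set (Lp_integrable_norm_sq u₀).integrableOn
      (ae_of_all _ fun z => by positivity)
      (compl_subset_compl.2 (subset_toMeasurable _ _)).eventuallyLE
  have i2 : ∫ z in Ω'ᶜ, ‖(u t) z‖ ^ 2 ≤ ∫ z in Ωᶜ, ‖(u t) z‖ ^ 2 :=
    setIntegral_mono_set (Lp_integrable_norm_sq (u t)).integrableOn
      (ae_of_all _ fun z => by positivity)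
      (compl_subset_compl.2 (subset_toMeasurable _ _)).eventuallyLE
  have hB : B = M⁻¹ * ∫ z in Ω'ᶜ, ‖(u t) z‖ ^ 2 := by
    rw [e2, inv_mul_cancel_left₀ hM.ne']
  rw [e0, e1, hB] at hAf
  have p1 : 0 ≤ ∫ z in Eᶜ, ‖u₀ z‖ ^ 2 := integral_nonneg fun z => by positivity
  have p2 : 0 ≤ ∫ z in Ωᶜ, ‖(u t) z‖ ^ 2 := integral_nonneg fun z => by positivity
  refine hAf.trans ?_
  rw [mul_assoc]
  refine mul_le_mul_of_nonneg_left ?_ hC.le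
  have i3 := mul_le_mul_of_nonneg_left i2 (inv_pos.2 hM).le
  have p3 := mul_nonneg (inv_pos.2 hM).le p1
  linarith
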